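/- Let $\mathfrak A\subseteq\mathcal B(\mathcal H)$ be a semifinite factor (a von Neumann algebra with trivial center) that is not of type $\mathrm I_2$, with a normal faithful semifinite tracial weight $\tau$, and let $c$ be a real number with $0<c<\tau(I)/2$ (where $\tau(I)=\infty$ is allowed). Let $\mathscr P_c$ be the set of all orthogonal projections $P\in\mathfrak A$ with $\tau(P)=c$, and let $\varphi:\mathscr P_c\to\mathscr P_c$ be a (not necessarily bijective) map that preserves the transition probability, i.e. $$\tau(\varphi(P)\varphi(Q))=\tau(PQ)\qquad\text{for all }P,Q\in\mathscr P_c .$$ Let $P_1,P_2,Q\in\mathscr P_c$ with $P_1P_2=P_2P_1$. If $Q\le P_1\vee P_2$, then $\varphi(Q)\le\varphi(P_1)\vee\varphi(P_2)$. Here $P\vee P'$ denotes the least upper bound of the projections $P$ and $P'$, i.e. the projection onto the closure of the sum of their ranges, and $\tau(PQ)$ is the value at $PQ$ of the linear extension of $\tau$ to the linear span of the positive elements of finite trace. -/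

import Mathlib

open scoped NNReal ENNReal

namespace SemifiniteFactor

section

variable {H : Type*} [NormedAddCommGroup H] [InnerProductSpace ℂ H] [CompleteSpace H]

/-- A von Neumann algebra is a factor if its center consists of the multiples of the identity. -/
def IsFactor (M : VonNeumannAlgebra H) : Prop :=
  ∀ A : H →L[ℂ] H, A ∈ M → A ∈ M.commutant → ∃ z : ℂ, A = z • (1 : H →L[ℂ] H)

/-! ### Positive elements -/

theorem smul_mem_vN (M : VonNeumannAlgebra H) (z : ℂ) {A : H →L[ℂ] H} (hA : A ∈ M) :
    z • A ∈ M :=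
  M.toStarSubalgebra.smul_mem hA z

/-- The cone of positive elements of `M`. -/
noncomputable def posCone (M : VonNeumannAlgebra H) : Submodule ℝ≥0 (H →L[ℂ] H) where
  carrier := {A | A ∈ M ∧ 0 ≤ A}
  add_mem' := fun ha hb => ⟨add_mem ha.1 hb.1, add_nonneg ha.2 hb.2⟩
  zero_mem' := ⟨zero_mem M, le_rfl⟩
  smul_mem' := fun r A hA => by
    refine ⟨?_, ?_⟩
    · have h : r • A = ((r : ℝ) : ℂ) • A := by
        ext x
        simp [NNReal.smul_def]
      rw [h]
      exact smul_mem_vN M _ hA.1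
    · exact smul_nonneg r.2 hA.2

noncomputable instance (M : VonNeumannAlgebra H) : SMul ℝ≥0 (posCone M) :=
  Submodule.smul (posCone M)

/-- The positive element `A* A` of `M`. -/
noncomputable def starMulSelf {M : VonNeumannAlgebra H} (A : M) : posCone M :=
  ⟨star (A : H →L[ℂ] H) * A, mul_mem (star_mem A.2) A.2, star_mul_self_nonneg _⟩

/-- The positive element `A A*` of `M`. -/
noncomputable def mulStarSelf {M : VonNeumannAlgebra H} (A : M) : posCone M :=
  ⟨A * star (A : H →L[ℂ] H), mul_mem A.2 (star_mem A.2), mul_star_self_nonneg _⟩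

/-! ### Projections -/

/-- The orthogonal projections of `M`, with the order of operators (`P ≤ Q` if and only if
`Q - P` is a positive operator). -/
def Proj (M : VonNeumannAlgebra H) : Type _ :=
  {P : H →L[ℂ] H // P ∈ M ∧ IsStarProjection P}

instance (M : VonNeumannAlgebra H) : PartialOrder (Proj M) :=
  inferInstanceAs (PartialOrder {P : H →L[ℂ] H // P ∈ M ∧ IsStarProjection P})

/-- The underlying operator of a projection. -/
def Proj.op {M : VonNeumannAlgebra H} (P : Proj M) : H →L[ℂ] H := P.1

/-- A projection of `M` as a positive element of `M`. -/
noncomputable def Proj.toPos {M : VonNeumannAlgebra H} (P : Proj M) : posCone M :=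
  ⟨P.op, P.2.1, P.2.2.nonneg⟩

/-- The zero projection. -/
noncomputable def Proj.bot (M : VonNeumannAlgebra H) : Proj M :=
  ⟨0, zero_mem M, .zero _⟩

/-- The identity `I`. -/
noncomputable def Proj.top (M : VonNeumannAlgebra H) : Proj M :=
  ⟨1, one_mem M, .one _⟩

/-- A projection is determined by its range, and the order is the inclusion of ranges. -/
theorem Proj.le_iff_range {M : VonNeumannAlgebra H} (P Q : Proj M) :
    P ≤ Q ↔ P.op.range ≤ Q.op.range := by
  obtain ⟨hp, hpe⟩ := isStarProjection_iff_eq_starProjection_range.mp P.2.2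
  obtain ⟨hq, hqe⟩ := isStarProjection_iff_eq_starProjection_range.mp Q.2.2
  have h : P ≤ Q ↔ P.1 ≤ Q.1 := Iff.rfl
  rw [h, hpe, hqe, Submodule.starProjection_le_starProjection_iff]
  rfl

/-- The operator of orthogonal projection onto the closure of `ran P + ran Q`. -/
noncomputable def supOp (P Q : H →L[ℂ] H) : H →L[ℂ] H :=
  (P.range ⊔ Q.range).topologicalClosure.starProjection

theorem range_supOp (P Q : H →L[ℂ] H) :
    (supOp P Q).range = (P.range ⊔ Q.range).topologicalClosure := by
  simp [supOp]

theorem supOp_mem {M : VonNeumannAlgebra H} (P Q : Proj M) : supOp P.op Q.op ∈ M := by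
  have hs : IsStarProjection (supOp P.op Q.op) := isStarProjection_starProjection
  rw [VonNeumannAlgebra.IsStarProjection.mem_iff hs]
  intro y hy
  have hP := (VonNeumannAlgebra.IsStarProjection.mem_iff P.2.2 M).1 P.2.1 y hy
  have hQ := (VonNeumannAlgebra.IsStarProjection.mem_iff Q.2.2 M).1 Q.2.1 y hy
  rw [Module.End.mem_invtSubmodule] at hP hQ ⊢
  rw [range_supOp]
  refine Submodule.topologicalClosure_minimal _ ?_ ?_
  · refine sup_le (hP.trans ?_) (hQ.trans ?_)
    · exact Submodule.comap_mono (le_sup_left.trans (Submodule.le_topologicalClosure _))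
    · exact Submodule.comap_mono (le_sup_right.trans (Submodule.le_topologicalClosure _))
  · exact (Submodule.isClosed_topologicalClosure _).preimage y.continuous

/-- The join `P ∨ Q`, the projection onto the closure of `ran P + ran Q`. -/
noncomputable def Proj.join {M : VonNeumannAlgebra H} (P Q : Proj M) : Proj M :=
  ⟨supOp P.op Q.op, supOp_mem P Q, isStarProjection_starProjection⟩

theorem Proj.range_join {M : VonNeumannAlgebra H} (P Q : Proj M) :
    (P.join Q).op.range = (P.op.range ⊔ Q.op.range).topologicalClosure :=
  range_supOp P.op Q.op

/-- The join `P ∨ Q = P ⊔ Q` is the least upper bound of `P` and `Q`. -/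
noncomputable instance (M : VonNeumannAlgebra H) : SemilatticeSup (Proj M) where
  sup P Q := P.join Q
  le_sup_left P Q := by
    rw [Proj.le_iff_range, Proj.range_join]
    exact le_sup_left.trans (Submodule.le_topologicalClosure _)
  le_sup_right P Q := by
    rw [Proj.le_iff_range, Proj.range_join]
    exact le_sup_right.trans (Submodule.le_topologicalClosure _)
  sup_le P Q R hP hQ := by
    rw [Proj.le_iff_range] at hP hQ
    rw [Proj.le_iff_range, Proj.range_join]
    exact Submodule.topologicalClosure_minimal _ (sup_le hP hQ)
      (ContinuousLinearMap.IsIdempotentElem.isClosed_range R.2.2.isIdempotentElem)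

/-- A minimal projection of `M`: a nonzero projection that dominates no projection of `M`
other than `0` and itself. -/
def IsMinimalProj {M : VonNeumannAlgebra H} (P : Proj M) : Prop :=
  P ≠ Proj.bot M ∧ ∀ Q : Proj M, Q ≤ P → Q = Proj.bot M ∨ Q = P

/-- A factor is of type `I₂` if the identity is the sum of two minimal projections (which are then
orthogonal and, in a factor, equivalent). -/
def IsTypeI₂ (M : VonNeumannAlgebra H) : Prop :=
  IsFactor M ∧ ∃ P Q : Proj M, IsMinimalProj P ∧ IsMinimalProj Q ∧ P.op + Q.op = 1

/-! ### Traces -/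

/-- A weight on `M` is an additive and positively homogeneous map from the positive cone to
`[0, ∞]`, that is, an `ℝ≥0`-linear map. This is the property of being a normal faithful semifinite
tracial weight. -/
structure IsTrace {M : VonNeumannAlgebra H} (τ : posCone M →ₗ[ℝ≥0] ℝ≥0∞) : Prop where
  tracial : ∀ A : M, τ (starMulSelf A) = τ (mulStarSelf A)
  faithful : ∀ A : posCone M, τ A = 0 → A = 0
  normal : ∀ D : Set (posCone M), D.Nonempty → DirectedOn (· ≤ ·) D →
    ∀ A : posCone M, IsLUB D A → τ A = ⨆ B ∈ D, τ B
  semifinite : ∀ A : posCone M, A ≠ 0 → ∃ B : posCone M, B ≤ A ∧ B ≠ 0 ∧ τ B < ∞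

/-- `A = A₀ - A₁ + i (A₂ - A₃)` with `Aⱼ` positive of finite trace, and
`z = τ(A₀) - τ(A₁) + i (τ(A₂) - τ(A₃))`. -/
def IsTraceValue {M : VonNeumannAlgebra H} (τ : posCone M →ₗ[ℝ≥0] ℝ≥0∞)
    (A : H →L[ℂ] H) (z : ℂ) : Prop :=
  ∃ a : Fin 4 → posCone M, (∀ j, τ (a j) < ∞) ∧
    A = ((a 0 : H →L[ℂ] H) - a 1) + Complex.I • ((a 2 : H →L[ℂ] H) - a 3) ∧
    z = (((τ (a 0)).toReal - (τ (a 1)).toReal : ℝ) : ℂ) +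
      Complex.I * (((τ (a 2)).toReal - (τ (a 3)).toReal : ℝ) : ℂ)

theorem IsTraceValue.unique {M : VonNeumannAlgebra H} {τ : posCone M →ₗ[ℝ≥0] ℝ≥0∞}
    {A : H →L[ℂ] H} {z w : ℂ} (hz : IsTraceValue τ A z) (hw : IsTraceValue τ A w) : z = w := by
  obtain ⟨a, ha, hA, rfl⟩ := hz
  obtain ⟨b, hb, hB, rfl⟩ := hw
  have hsa : ∀ x : posCone M, star (x : H →L[ℂ] H) = x := fun x =>
    (IsSelfAdjoint.of_nonneg x.2.2).star_eq
  have hAB := hA.symm.trans hB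
  have hst := congrArg star hAB
  simp only [star_add, star_sub, star_smul, hsa, Complex.star_def, Complex.conj_I] at hst
  have hre : (a 0 : H →L[ℂ] H) - a 1 = b 0 - b 1 := by
    have h2 : (2 : ℂ) • ((a 0 : H →L[ℂ] H) - a 1) = (2 : ℂ) • ((b 0 : H →L[ℂ] H) - b 1) := by
      have e : ∀ X Y : H →L[ℂ] H,
          (2 : ℂ) • X = (X + Complex.I • Y) + (X + (-Complex.I) • Y) := fun X Y => by module
      rw [e _ ((a 2 : H →L[ℂ] H) - a 3), hAB, hst, ← e]
    exact smul_right_injective _ two_ne_zero h2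
  have him : (a 2 : H →L[ℂ] H) - a 3 = b 2 - b 3 := by
    rw [hre] at hAB
    exact smul_right_injective _ Complex.I_ne_zero (add_left_cancel hAB)
  have key : ∀ i j : Fin 4, (a i : H →L[ℂ] H) - a j = b i - b j →
      (τ (a i)).toReal - (τ (a j)).toReal = (τ (b i)).toReal - (τ (b j)).toReal := by
    intro i j hij
    have h1 : a i + b j = b i + a j := Subtype.ext (sub_eq_sub_iff_add_eq_add.1 hij)
    have h2 := congrArg ENNReal.toReal (congrArg τ h1)
    rw [map_add, map_add, ENNReal.toReal_add (ha i).ne (hb j).ne,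
      ENNReal.toReal_add (hb i).ne (ha j).ne] at h2
    linarith
  rw [key 0 1 hre, key 2 3 him]

open Classical in
/-- The linear extension of `τ` to its ideal of definition, the linear span of the positive
elements of finite trace (and `0` off this ideal). If `P` and `Q` are projections of finite trace,
then `P Q` lies in this ideal. -/
noncomputable def tr {M : VonNeumannAlgebra H} (τ : posCone M →ₗ[ℝ≥0] ℝ≥0∞)
    (A : H →L[ℂ] H) : ℂ :=
  if h : ∃ z, IsTraceValue τ A z then h.choose else 0

theorem tr_eq {M : VonNeumannAlgebra H} {τ : posCone M →ₗ[ℝ≥0] ℝ≥0∞}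
    {A : H →L[ℂ] H} {z : ℂ} (hz : IsTraceValue τ A z) : tr τ A = z := by
  have h : ∃ z, IsTraceValue τ A z := ⟨z, hz⟩
  rw [tr, dif_pos h]
  exact h.choose_spec.unique hz

/-- The Grassmann space of all projections of trace `c`. -/
def Grassmann {M : VonNeumannAlgebra H} (τ : posCone M →ₗ[ℝ≥0] ℝ≥0∞) (c : ℝ) :
    Set (Proj M) :=
  {P | τ P.toPos = ENNReal.ofReal c}

/-- `φ` preserves the transition probability: `τ(φ(P) φ(Q)) = τ(P Q)`. -/
def PreservesTransitionProbability {M : VonNeumannAlgebra H} (τ : posCone M →ₗ[ℝ≥0] ℝ≥0∞)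
    {c : ℝ} (φ : Grassmann τ c → Grassmann τ c) : Prop :=
  ∀ P Q : Grassmann τ c, tr τ ((φ P).1.op * (φ Q).1.op) = tr τ (P.1.op * Q.1.op)

end

end SemifiniteFactor

/-!
The map `φ` preserves `τ(P Q)` for projections `P`, `Q` of trace `c`. By faithfulness it preserves
orthogonality, and since `τ(X* X)` of `X = P + Q - R - S` is a combination of such values, it also
preserves the relations `P + Q = R + S`. Nothing else about `φ` is used (`IsOrthoAdditive`).

Write `P₁ = E + F₁` and `P₂ = E + F₂` with `E = P₁ P₂`. As `2 c < τ(1)`, comparison of projections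
gives a copy `E'` of `E` orthogonal to the join `E + F₁ + F₂`. Put `W = E + E' + F₁ + F₂`, of trace
`2 c`, and `R₁ = E' + F₁`, `R₂ = E' + F₂`, `V = W - Q`. Then
`φ(P₁) + φ(R₂) = φ(P₂) + φ(R₁) = φ(Q) + φ(V)` are three decompositions of one projection `w`. If
`φ(R₁)` and `φ(R₂)` commute, then the join of `φ(P₁)` and `φ(P₂)` is `w - φ(R₁) φ(R₂)`, so the claim
says that `φ(V)` dominates `φ(R₁) φ(R₂)`, where `V` dominates `R₁ R₂ = E'`
(`IsOrthoAdditive.mul_eq_of_le`).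

Both facts are proved together in `IsOrthoAdditive.frame`. If `E'` has a copy `y` under the nonzero
projection `Y = 1 - W`, then `E'`, `E` and `y` are three mutually orthogonal copies `Eᵢ` of `E'`.
The images of `Eᵢ + F₁` and `Eⱼ + F₂` are orthogonal for `i ≠ j`, and their differences for `i = j`
agree, so that a computation with projections gives commutation (`commute_of_sub_eq_sub`). The
relation `E' + F₁ - (y + F₁) = V - (V - E' + y)` gives the domination (`mul_sub_mul_eq`).
Otherwise `E'` is cut into finitely many parts not exceeding `Y`, and additivity reduces the claim
to the parts. It is here that `c < τ(1) / 2` is needed: for `c = τ(1) / 2` there is no third copy.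

Comparison is only needed at the level of traces (`IsFactor.comparison`). It rests on polar
decomposition inside `M` and on normality of the trace along increasing nets of projections, so that
no distinction of types is made.
-/

namespace SemifiniteFactor

section

variable {H : Type*} [NormedAddCommGroup H] [InnerProductSpace ℂ H] [CompleteSpace H]

/-! ### Projections in a von Neumann algebra -/

theorem starProjection_topologicalClosure_mem (M : VonNeumannAlgebra H) (U : Submodule ℂ H)
    (hU : ∀ y ∈ M.commutant, ∀ x ∈ U, y x ∈ U) :
    U.topologicalClosure.starProjection ∈ M := by
  rw [VonNeumannAlgebra.IsStarProjection.mem_iff isStarProjection_starProjection]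
  intro y hy
  rw [Module.End.mem_invtSubmodule, Submodule.range_starProjection]
  refine Submodule.topologicalClosure_minimal _ (fun x hx => ?_)
    ((Submodule.isClosed_topologicalClosure _).preimage y.continuous)
  exact Submodule.le_topologicalClosure _ (hU y hy x hx)

/-- In a factor, any two nonzero elements are linked: the closed span of `M a H` is invariant under
both `M` and its commutant, so its projection is central, hence the identity. -/
theorem IsFactor.exists_mul_mul_ne_zero {M : VonNeumannAlgebra H} (hM : IsFactor M)
    {a b : H →L[ℂ] H} (ha : a ∈ M) (ha0 : a ≠ 0) (hb0 : b ≠ 0) :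
    ∃ x ∈ M, b * x * a ≠ 0 := by
  by_contra! h
  let U : Submodule ℂ H := Submodule.span ℂ {v | ∃ x ∈ M, ∃ w, v = x (a w)}
  have hmem : U.topologicalClosure.starProjection ∈ M := by
    refine starProjection_topologicalClosure_mem M U fun y hy v hv => ?_
    refine (Submodule.span_le (p := U.comap (y : H →ₗ[ℂ] H))).2 ?_ hv
    rintro _ ⟨x, hx, w, rfl⟩
    refine Submodule.subset_span ⟨x, hx, y w, ?_⟩
    have h1 := VonNeumannAlgebra.mem_commutant_iff.1 hy (x * a) (mul_mem hx ha)
    exact (DFunLike.congr_fun h1 w).symm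
  have hmem' : U.topologicalClosure.starProjection ∈ M.commutant := by
    refine starProjection_topologicalClosure_mem M.commutant U fun y hy v hv => ?_
    rw [VonNeumannAlgebra.commutant_commutant] at hy
    refine (Submodule.span_le (p := U.comap (y : H →ₗ[ℂ] H))).2 ?_ hv
    rintro _ ⟨x, hx, w, rfl⟩
    exact Submodule.subset_span ⟨y * x, mul_mem hy hx, w, rfl⟩
  obtain ⟨z, hz⟩ := hM _ hmem hmem'
  have hbU : ∀ v ∈ U.topologicalClosure, b v = 0 := by
    have hle : U.topologicalClosure ≤ (LinearMap.ker (b : H →ₗ[ℂ] H)) := by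
      refine Submodule.topologicalClosure_minimal _ (Submodule.span_le.2 ?_) b.isClosed_ker
      rintro _ ⟨x, hx, w, rfl⟩
      exact DFunLike.congr_fun (h x hx) w
    exact fun v hv => hle hv
  obtain ⟨w, hw⟩ : ∃ w, a w ≠ 0 := by
    by_contra! h0
    exact ha0 (ContinuousLinearMap.ext h0)
  have haw : a w ∈ U.topologicalClosure :=
    Submodule.le_topologicalClosure _ (Submodule.subset_span ⟨1, one_mem M, w, rfl⟩)
  have hz0 : z ≠ 0 := by
    rintro rfl
    have h1 := Submodule.starProjection_eq_self_iff.2 haw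
    rw [hz] at h1
    exact hw (by simpa using h1.symm)
  refine hb0 (ContinuousLinearMap.ext fun v => ?_)
  have h1 : z • v ∈ U.topologicalClosure := by
    have h2 := U.topologicalClosure.starProjection_apply_mem v
    rw [hz] at h2
    simpa using h2
  have h3 := (U.topologicalClosure.smul_mem_iff hz0).1 h1
  simpa using hbU v h3

theorem norm_abs_apply (x : H →L[ℂ] H) (h : H) : ‖CFC.abs x h‖ = ‖x h‖ := by
  have hsa : star (CFC.abs x) = CFC.abs x := (CFC.abs_nonneg x).isSelfAdjoint.star_eq
  have h1 : ∀ T : H →L[ℂ] H, ‖T h‖ ^ 2 = RCLike.re (inner ℂ ((star T * T) h) h) := by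
    intro T
    rw [ContinuousLinearMap.star_eq_adjoint, mul_apply_eq_comp,
      ContinuousLinearMap.adjoint_inner_left, inner_self_eq_norm_sq]
  have h2 : ‖CFC.abs x h‖ ^ 2 = ‖x h‖ ^ 2 := by
    rw [h1, h1, hsa, CFC.abs_mul_abs]
  exact (sq_eq_sq₀ (norm_nonneg _) (norm_nonneg _)).1 h2

/-- Polar decomposition inside a von Neumann algebra: every nonzero `x` in `M` has a phase, a nonzero
partial isometry `v` of `M` whose supports lie under those of `x`. -/
theorem exists_partialIsometry {M : VonNeumannAlgebra H} {x : H →L[ℂ] H} (hx : x ∈ M)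
    (hx0 : x ≠ 0) :
    ∃ v ∈ M, v ≠ 0 ∧ IsStarProjection (star v * v) ∧ v * (star v * v) = v ∧
      (∀ q, q * x = x → q * v = v) ∧ (∀ p, x * p = x → v * p = v) := by
  set m := CFC.abs x
  have hms : star m = m := (CFC.abs_nonneg x).isSelfAdjoint.star_eq
  let K : Submodule ℂ H := (LinearMap.range (m : H →ₗ[ℂ] H)).topologicalClosure
  have hmK : ∀ h, m h ∈ K := fun h =>
    Submodule.le_topologicalClosure _ (LinearMap.mem_range_self _ h)
  let e : H →ₗ[ℂ] K := (m : H →ₗ[ℂ] H).codRestrict K hmK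
  have he : DenseRange e := by
    rw [DenseRange, Subtype.dense_iff]
    intro k hk
    have : ((fun k : K => (k : H)) '' Set.range e) = (LinearMap.range (m : H →ₗ[ℂ] H) : Set H) := by
      ext w
      constructor
      · rintro ⟨_, ⟨h, rfl⟩, rfl⟩
        exact ⟨h, rfl⟩
      · rintro ⟨h, rfl⟩
        exact ⟨e h, ⟨h, rfl⟩, rfl⟩
    exact this ▸ hk
  let v₀ : K →L[ℂ] H := (x : H →ₗ[ℂ] H).extendOfNorm e
  have hv₀ : ∀ h, v₀ (e h) = x h := fun h =>
    LinearMap.extendOfNorm_eq he ⟨1, fun h => by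
      rw [one_mul]; exact (norm_abs_apply x h).symm.le⟩ h
  have hv₀n : ∀ k : K, ‖v₀ k‖ = ‖k‖ := by
    intro k
    refine he.induction_on (p := fun k => ‖v₀ k‖ = ‖k‖) k
      (isClosed_eq (by fun_prop) (by fun_prop)) fun h => ?_
    rw [hv₀]
    exact (norm_abs_apply x h).symm
  let v : H →L[ℂ] H := v₀ ∘L K.orthogonalProjectionOnto
  have hvm : ∀ h, v (m h) = x h := by
    intro h
    rw [← hv₀]
    simp only [v, ContinuousLinearMap.comp_apply]
    congr 1
    exact Submodule.orthogonalProjectionOnto_mem_subspace_eq_self (e h)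
  have hvP : v * K.starProjection = v := by
    ext h
    simp only [v, mul_apply_eq_comp, ContinuousLinearMap.comp_apply]
    congr 1
    exact Submodule.orthogonalProjectionOnto_mem_subspace_eq_self (K.orthogonalProjectionOnto h)
  have hext : ∀ A B : H →L[ℂ] H, A * m = B * m →
      A * K.starProjection = B * K.starProjection := by
    intro A B hAB
    have hle : K ≤ LinearMap.ker ((A - B : H →L[ℂ] H) : H →ₗ[ℂ] H) := by
      refine Submodule.topologicalClosure_minimal _ ?_ (A - B).isClosed_ker
      rintro _ ⟨h, rfl⟩
      have := DFunLike.congr_fun hAB h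
      simpa [sub_eq_zero] using this
    ext h
    have := hle (K.starProjection_apply_mem h)
    simpa [sub_eq_zero] using this
  have hvmx : v * m = x := ContinuousLinearMap.ext hvm
  have hPs : star K.starProjection = K.starProjection :=
    (isStarProjection_starProjection (U := K)).isSelfAdjoint.star_eq
  -- a right identity of `x` is one of `|x|`, since `‖|x| h‖ = ‖x h‖`
  have hright : ∀ p : H →L[ℂ] H, x * p = x → m * p = m := by
    intro p hp
    ext h
    have h1 : x (p h - h) = 0 := by
      rw [map_sub, sub_eq_zero]
      exact DFunLike.congr_fun hp h
    have h2 : m (p h - h) = 0 := by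
      rw [← norm_eq_zero, norm_abs_apply, h1, norm_zero]
    rw [map_sub, sub_eq_zero] at h2
    exact h2
  have hvv : star v * v = K.starProjection := by
    have hn : ∀ h, ‖v h‖ = ‖K.starProjection h‖ := fun h => hv₀n _
    have hsq : ∀ T : H →L[ℂ] H, ∀ h, inner ℂ ((star T * T) h) h = ((‖T h‖ : ℂ)) ^ 2 := by
      intro T h
      rw [ContinuousLinearMap.star_eq_adjoint, mul_apply_eq_comp,
        ContinuousLinearMap.adjoint_inner_left, inner_self_eq_norm_sq_to_K]
      rfl
    have h1 : star v * v = star K.starProjection * K.starProjection := by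
      refine ContinuousLinearMap.coe_injective ?_
      rw [← ext_inner_map]
      intro h
      exact (hsq v h).trans ((by rw [hn]) : _ = _) |>.trans (hsq K.starProjection h).symm
    rw [h1, hPs]
    exact (isStarProjection_starProjection (U := K)).isIdempotentElem
  refine ⟨v, ?_, ?_, ?_, ?_, ?_, ?_⟩
  · have hcomm : ∀ y ∈ M.commutant, Commute y m := by
      intro y hy
      rw [VonNeumannAlgebra.mem_commutant_iff] at hy
      exact (Commute.cfcAbs_left (hy x hx)
        (show x * star y = star y * x by simpa using congrArg star (hy _ (star_mem hx)).symm)).symm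
    have hPM : K.starProjection ∈ M := by
      refine starProjection_topologicalClosure_mem M _ ?_
      rintro y hy _ ⟨h, rfl⟩
      exact ⟨y h, (DFunLike.congr_fun (hcomm y hy).eq h).symm⟩
    rw [← VonNeumannAlgebra.commutant_commutant M, VonNeumannAlgebra.mem_commutant_iff]
    intro y hy
    have hyx := VonNeumannAlgebra.mem_commutant_iff.1 hy x hx
    have hyP := VonNeumannAlgebra.mem_commutant_iff.1 hy _ hPM
    have h1 := hext (y * v) (v * y)
      (by rw [mul_assoc, hvmx, mul_assoc, (hcomm y hy).eq, ← mul_assoc, hvmx, hyx])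
    rwa [mul_assoc, hvP, mul_assoc, ← hyP, ← mul_assoc, hvP] at h1
  · rintro h0
    rw [h0, zero_mul] at hvmx
    exact hx0 hvmx.symm
  · rw [hvv]
    exact isStarProjection_starProjection
  · rw [hvv, hvP]
  · intro q hq
    have h1 := hext (q * v) v (by rw [mul_assoc, hvmx, hq])
    rwa [mul_assoc, hvP] at h1
  · intro p hp
    have h1 : star p * m = m := by simpa [hms] using congrArg star (hright p hp)
    have h2 : star p * K.starProjection = K.starProjection := by
      simpa using hext (star p) 1 (by rw [h1, one_mul])
    have h3 : K.starProjection * p = K.starProjection := by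
      simpa [hPs] using congrArg star h2
    rw [← hvP, mul_assoc, h3]

/-- The projections of `M`, as a predicate on operators. -/
def IsProj (M : VonNeumannAlgebra H) (A : H →L[ℂ] H) : Prop :=
  A ∈ M ∧ IsStarProjection A

theorem Proj.isProj {M : VonNeumannAlgebra H} (P : Proj M) : IsProj M P.op := P.2

section IsProj

variable {M : VonNeumannAlgebra H} {A B : H →L[ℂ] H}

theorem IsProj.mem_posCone (hA : IsProj M A) : A ∈ posCone M := ⟨hA.1, hA.2.nonneg⟩

theorem IsProj.mul_self (hA : IsProj M A) : A * A = A := hA.2.isIdempotentElem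

theorem IsProj.star_eq (hA : IsProj M A) : star A = A := hA.2.isSelfAdjoint.star_eq

theorem IsProj.one_sub (hA : IsProj M A) : IsProj M (1 - A) :=
  ⟨sub_mem (one_mem M) hA.1, hA.2.one_sub⟩

theorem IsProj.mul_comm_of_eq_zero (hA : IsProj M A) (hB : IsProj M B) (h : A * B = 0) :
    B * A = 0 := by
  simpa [hA.star_eq, hB.star_eq] using congrArg star h

theorem IsProj.mul_comm_of_eq_right (hA : IsProj M A) (hB : IsProj M B) (h : A * B = B) :
    B * A = B := by
  simpa [hA.star_eq, hB.star_eq] using congrArg star h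

theorem IsProj.add (hA : IsProj M A) (hB : IsProj M B) (h : A * B = 0) : IsProj M (A + B) :=
  ⟨add_mem hA.1 hB.1, hA.2.add hB.2 h⟩

theorem IsProj.sub (hA : IsProj M A) (hB : IsProj M B) (h : A * B = B) : IsProj M (A - B) :=
  ⟨sub_mem hA.1 hB.1, hB.2.sub_of_mul_eq_right hA.2 h⟩

theorem IsProj.mul (hA : IsProj M A) (hB : IsProj M B) (h : A * B = B * A) : IsProj M (A * B) :=
  ⟨mul_mem hA.1 hB.1, hA.2.mul hB.2 h⟩

theorem Proj.le_iff_mul_eq {P Q : Proj M} : P ≤ Q ↔ Q.op * P.op = P.op :=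
  IsStarProjection.le_iff_mul_eq_right P.2.2 Q.2.2

end IsProj

/-! ### Traces of operators -/

open Classical in
/-- The trace as a function on all operators, equal to `0` off the positive cone of `M`. -/
noncomputable def opTrace {M : VonNeumannAlgebra H} (τ : posCone M →ₗ[ℝ≥0] ℝ≥0∞)
    (A : H →L[ℂ] H) : ℝ≥0∞ :=
  if h : A ∈ posCone M then τ ⟨A, h⟩ else 0

section opTrace

variable {M : VonNeumannAlgebra H} {τ : posCone M →ₗ[ℝ≥0] ℝ≥0∞} {A B : H →L[ℂ] H}

theorem opTrace_eq (hA : A ∈ posCone M) : opTrace τ A = τ ⟨A, hA⟩ := dif_pos hA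

theorem opTrace_toPos (P : Proj M) : opTrace τ P.op = τ P.toPos :=
  opTrace_eq P.isProj.mem_posCone

theorem opTrace_add (hA : A ∈ posCone M) (hB : B ∈ posCone M) :
    opTrace τ (A + B) = opTrace τ A + opTrace τ B := by
  rw [opTrace_eq hA, opTrace_eq hB, opTrace_eq (add_mem hA hB), ← map_add]
  rfl

theorem opTrace_zero : opTrace τ (0 : H →L[ℂ] H) = 0 := by
  rw [opTrace_eq (zero_mem (posCone M))]
  exact map_zero τ

theorem opTrace_star_mul_self (hτ : IsTrace τ) (hA : A ∈ M) :
    opTrace τ (star A * A) = opTrace τ (A * star A) := by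
  rw [opTrace_eq (A := star A * A) (starMulSelf (⟨A, hA⟩ : M)).2,
    opTrace_eq (A := A * star A) (mulStarSelf (⟨A, hA⟩ : M)).2]
  exact hτ.tracial ⟨A, hA⟩

theorem opTrace_eq_zero (hτ : IsTrace τ) (hA : A ∈ posCone M) (h : opTrace τ A = 0) : A = 0 := by
  rw [opTrace_eq hA] at h
  exact congrArg Subtype.val (hτ.faithful _ h)

theorem opTrace_sub_add (hA : IsProj M A) (hB : IsProj M B) (h : A * B = B) :
    opTrace τ (A - B) + opTrace τ B = opTrace τ A := by
  rw [← opTrace_add (hA.sub hB h).mem_posCone hB.mem_posCone, sub_add_cancel]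

end opTrace

/-! ### Comparison of projections in a factor -/

section Comparison

variable {M : VonNeumannAlgebra H} {τ : posCone M →ₗ[ℝ≥0] ℝ≥0∞}

/-- An increasing net of projections has a supremum, its strong limit; the trace is continuous
along the net. -/
theorem exists_proj_sup (hτ : IsTrace τ) {ι : Type*} [Preorder ι] [IsDirectedOrder ι] [Nonempty ι]
    (P : ι → Proj M) (hP : Monotone P) :
    ∃ R : Proj M, (∀ i, P i ≤ R) ∧ (∀ K, (∀ i, P i ≤ K) → R ≤ K) ∧
      τ R.toPos = ⨆ i, τ (P i).toPos := by
  let U : ι → Submodule ℂ H := fun i => LinearMap.range ((P i).op : H →ₗ[ℂ] H)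
  have hUm : Monotone U := fun i j hij => (Proj.le_iff_range _ _).1 (hP hij)
  have hUP : ∀ i, ∃ _ : (U i).HasOrthogonalProjection, (P i).op = (U i).starProjection :=
    fun i => isStarProjection_iff_eq_starProjection_range.mp (P i).2.2
  choose hUo hUP using hUP
  have hmem : (⨆ i, U i).topologicalClosure.starProjection ∈ M := by
    refine starProjection_topologicalClosure_mem M _ fun y hy => ?_
    change (⨆ i, U i) ≤ (⨆ i, U i).comap (y : H →ₗ[ℂ] H)
    refine iSup_le fun i => ?_
    have h1 := (VonNeumannAlgebra.IsStarProjection.mem_iff (P i).2.2 M).1 (P i).2.1 y hy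
    rw [Module.End.mem_invtSubmodule] at h1
    exact h1.trans (Submodule.comap_mono (le_iSup U i))
  let R : Proj M := ⟨_, hmem, isStarProjection_starProjection⟩
  have hR : LinearMap.range (R.op : H →ₗ[ℂ] H) = (⨆ i, U i).topologicalClosure :=
    Submodule.range_starProjection _
  have hle : ∀ i, P i ≤ R := by
    intro i
    rw [Proj.le_iff_range]
    exact (le_iSup U i).trans ((Submodule.le_topologicalClosure _).trans hR.ge)
  refine ⟨R, hle, ?_, ?_⟩
  · intro K hK
    rw [Proj.le_iff_range]
    refine hR.le.trans (Submodule.topologicalClosure_minimal _ (iSup_le fun i => ?_)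
      (ContinuousLinearMap.IsIdempotentElem.isClosed_range K.2.2.isIdempotentElem))
    exact (Proj.le_iff_range _ _).1 (hK i)
  · have hlub : IsLUB (Set.range fun i => (P i).toPos) R.toPos := by
      constructor
      · rintro _ ⟨i, rfl⟩
        exact hle i
      · intro B hB
        have hB' : ∀ i, (P i).op ≤ (B : H →L[ℂ] H) := fun i => hB ⟨i, rfl⟩
        change R.op ≤ (B : H →L[ℂ] H)
        rw [ContinuousLinearMap.le_def, ContinuousLinearMap.isPositive_def]
        refine ⟨((IsSelfAdjoint.of_nonneg B.2.2).sub R.2.2.isSelfAdjoint).isSymmetric, fun x => ?_⟩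
        have ht := Submodule.starProjection_tendsto_closure_iSup U hUm x
        have ht2 : Filter.Tendsto
            (fun i => RCLike.re (inner ℂ ((B : H →L[ℂ] H) x - (U i).starProjection x) x))
            Filter.atTop
            (nhds (RCLike.re (inner ℂ ((B : H →L[ℂ] H) x -
              (⨆ i, U i).topologicalClosure.starProjection x) x))) :=
          (RCLike.continuous_re.tendsto _).comp
            ((tendsto_const_nhds.sub ht).inner tendsto_const_nhds)
        refine ge_of_tendsto' ht2 fun i => ?_
        have := (ContinuousLinearMap.isPositive_def.1
          (ContinuousLinearMap.le_def _ _ |>.1 (hB' i))).2 x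
        rw [hUP i] at this
        exact this
    rw [hτ.normal _ (Set.range_nonempty _) ?_ _ hlub, iSup_range]
    rintro _ ⟨i, rfl⟩ _ ⟨j, rfl⟩
    obtain ⟨k, hik, hjk⟩ := exists_ge_ge i j
    exact ⟨_, ⟨k, rfl⟩, hP hik, hP hjk⟩

/-- Two nonzero projections of a factor dominate nonzero projections of equal trace, namely the
initial and final projections of a partial isometry. -/
theorem IsFactor.exists_isProj_le_le (hM : IsFactor M) (hτ : IsTrace τ) {E K : H →L[ℂ] H}
    (hE : IsProj M E) (hK : IsProj M K) (hE0 : E ≠ 0) (hK0 : K ≠ 0) :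
    ∃ p q, IsProj M p ∧ IsProj M q ∧ p ≠ 0 ∧ E * p = p ∧ K * q = q ∧
      opTrace τ p = opTrace τ q := by
  obtain ⟨a, ha, hx0⟩ := hM.exists_mul_mul_ne_zero hE.1 hE0 hK0
  obtain ⟨v, hv, hv0, hp, hvv, hq, hr⟩ :=
    exists_partialIsometry (mul_mem (mul_mem hK.1 ha) hE.1) hx0
  have hKv : K * v = v := hq K (by simp only [← mul_assoc, hK.mul_self])
  have hvE : v * E = v := hr E (by rw [mul_assoc, hE.mul_self])
  refine ⟨star v * v, v * star v, ⟨mul_mem (star_mem hv) hv, hp⟩,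
    ⟨mul_mem hv (star_mem hv), ?_, ?_⟩, ?_, ?_, ?_, opTrace_star_mul_self hτ hv⟩
  · rw [IsIdempotentElem]
    calc v * star v * (v * star v) = v * (star v * v) * star v := by simp only [mul_assoc]
      _ = v * star v := by rw [hvv]
  · simp [IsSelfAdjoint]
  · intro h0
    rw [h0, mul_zero] at hvv
    exact hv0 hvv.symm
  · have : E * star v = star v := by simpa [hE.star_eq] using congrArg star hvE
    rw [← mul_assoc, this]
  · rw [← mul_assoc, hKv]

/-- Comparison of projections in a factor, at the level of traces. A maximal pair of subprojections
of equal trace exhausts one of the two projections. -/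
theorem IsFactor.comparison (hM : IsFactor M) (hτ : IsTrace τ) {E K : H →L[ℂ] H}
    (hE : IsProj M E) (hK : IsProj M K) :
    (∃ B, IsProj M B ∧ K * B = B ∧ opTrace τ B = opTrace τ E) ∨
      ∃ A, IsProj M A ∧ E * A = A ∧ opTrace τ A = opTrace τ K := by
  let E' : Proj M := ⟨E, hE⟩
  let K' : Proj M := ⟨K, hK⟩
  let S : Set (Proj M × Proj M) := {s | s.1 ≤ E' ∧ s.2 ≤ K' ∧ τ s.1.toPos = τ s.2.toPos}
  have hchain : ∀ C ⊆ S, IsChain (· ≤ ·) C → ∀ y ∈ C, ∃ ub ∈ S, ∀ z ∈ C, z ≤ ub := by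
    intro C hCS hC y hy
    have : Nonempty C := ⟨⟨y, hy⟩⟩
    have : IsDirectedOrder C := ⟨fun a b => by
      rcases hC.total a.2 b.2 with h | h
      exacts [⟨b, h, le_rfl⟩, ⟨a, le_rfl, h⟩]⟩
    obtain ⟨R, hR1, hR2, hR3⟩ := exists_proj_sup hτ (fun s : C => s.1.1)
      fun a b h => (show a.1 ≤ b.1 from h).1
    obtain ⟨T, hT1, hT2, hT3⟩ := exists_proj_sup hτ (fun s : C => s.1.2)
      fun a b h => (show a.1 ≤ b.1 from h).2
    refine ⟨(R, T), ⟨hR2 _ fun s => (hCS s.2).1, hT2 _ fun s => (hCS s.2).2.1, ?_⟩,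
      fun z hz => ⟨hR1 ⟨z, hz⟩, hT1 ⟨z, hz⟩⟩⟩
    change τ R.toPos = τ T.toPos
    rw [hR3, hT3]
    exact iSup_congr fun s => (hCS s.2).2.2
  have hbot : (Proj.bot M, Proj.bot M) ∈ S := by
    refine ⟨Proj.le_iff_mul_eq.2 (mul_zero _), Proj.le_iff_mul_eq.2 (mul_zero _), rfl⟩
  obtain ⟨⟨A, B⟩, -, ⟨hAE, hBK, hAB⟩, hmax⟩ := zorn_le_nonempty₀ S hchain _ hbot
  have hAE' : E * A.op = A.op := Proj.le_iff_mul_eq.1 hAE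
  have hBK' : K * B.op = B.op := Proj.le_iff_mul_eq.1 hBK
  have hAB' : opTrace τ A.op = opTrace τ B.op := by rw [opTrace_toPos, opTrace_toPos, ← hAB]
  by_cases hA0 : E - A.op = 0
  · rw [sub_eq_zero] at hA0
    exact Or.inl ⟨B.op, B.isProj, hBK', by rw [hA0, hAB']⟩
  by_cases hB0 : K - B.op = 0
  · rw [sub_eq_zero] at hB0
    exact Or.inr ⟨A.op, A.isProj, hAE', by rw [hB0, hAB']⟩
  exfalso
  obtain ⟨p, q, hp, hq, hp0, hEp, hKq, hpq⟩ := hM.exists_isProj_le_le hτ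
    (hE.sub A.isProj hAE') (hK.sub B.isProj hBK') hA0 hB0
  have aux : ∀ {F G r : H →L[ℂ] H}, IsProj M F → IsProj M G → F * G = G → (F - G) * r = r →
      G * r = 0 ∧ F * (G + r) = G + r := by
    intro F G r hF hG hFG hr
    have h1 : G * r = 0 := by
      rw [← hr, ← mul_assoc, mul_sub, hG.mul_self, hF.mul_comm_of_eq_right hG hFG, sub_self,
        zero_mul]
    refine ⟨h1, ?_⟩
    rw [sub_mul, h1, sub_zero] at hr
    rw [mul_add, hFG, hr]
  obtain ⟨hAp, hEAp⟩ := aux hE A.isProj hAE' hEp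
  obtain ⟨hBq, hKBq⟩ := aux hK B.isProj hBK' hKq
  let A' : Proj M := ⟨A.op + p, A.isProj.add hp hAp⟩
  let B' : Proj M := ⟨B.op + q, B.isProj.add hq hBq⟩
  have hmem : (A', B') ∈ S := by
    refine ⟨Proj.le_iff_mul_eq.2 hEAp, Proj.le_iff_mul_eq.2 hKBq, ?_⟩
    change τ A'.toPos = τ B'.toPos
    rw [← opTrace_toPos, ← opTrace_toPos]
    change opTrace τ (A.op + p) = opTrace τ (B.op + q)
    rw [opTrace_add A.isProj.mem_posCone hp.mem_posCone,
      opTrace_add B.isProj.mem_posCone hq.mem_posCone, hAB', hpq]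
  have hle : (A, B) ≤ (A', B') := by
    constructor
    · refine Proj.le_iff_mul_eq.2 ?_
      change (A.op + p) * A.op = A.op
      rw [add_mul, A.isProj.mul_self, A.isProj.mul_comm_of_eq_zero hp hAp, add_zero]
    · refine Proj.le_iff_mul_eq.2 ?_
      change (B.op + q) * B.op = B.op
      rw [add_mul, B.isProj.mul_self, B.isProj.mul_comm_of_eq_zero hq hBq, add_zero]
  have h1 : A' ≤ A := (hmax hmem hle).1
  have h2 : A.op * (A.op + p) = A.op + p := Proj.le_iff_mul_eq.1 h1
  rw [mul_add, A.isProj.mul_self, hAp] at h2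
  exact hp0 (add_left_cancel h2).symm

/-- A projection of a factor dominates projections of every smaller finite trace that occurs. -/
theorem IsFactor.exists_isProj_le (hM : IsFactor M) (hτ : IsTrace τ) {E K : H →L[ℂ] H}
    (hE : IsProj M E) (hK : IsProj M K) (hle : opTrace τ E ≤ opTrace τ K) :
    ∃ B, IsProj M B ∧ K * B = B ∧ opTrace τ B = opTrace τ E := by
  rcases hM.comparison hτ hE hK with h | ⟨A, hA, hEA, hAK⟩
  · exact h
  · refine ⟨K, hK, hK.mul_self, le_antisymm ?_ hle⟩
    rw [← hAK, ← opTrace_sub_add hE hA hEA]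
    exact le_add_self

end Comparison

/-! ### The transition probability of two projections -/

section TransitionProbability

variable {M : VonNeumannAlgebra H} {τ : posCone M →ₗ[ℝ≥0] ℝ≥0∞} {P Q R S : H →L[ℂ] H}

theorem star_mul_self_mem_posCone {A : H →L[ℂ] H} (hA : A ∈ M) : star A * A ∈ posCone M :=
  ⟨mul_mem (star_mem hA) hA, star_mul_self_nonneg A⟩

theorem IsProj.mul_mul_mem_posCone (hP : IsProj M P) (hQ : IsProj M Q) :
    P * Q * P ∈ posCone M := by
  have h := star_mul_self_mem_posCone (mul_mem hQ.1 hP.1)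
  rwa [star_mul, hP.star_eq, hQ.star_eq, mul_assoc, ← mul_assoc Q, hQ.mul_self,
    ← mul_assoc] at h

theorem IsProj.add_mul_self_mem_posCone (hP : IsProj M P) (hQ : IsProj M Q) :
    (P + Q) * (P + Q) ∈ posCone M := by
  have h := star_mul_self_mem_posCone (add_mem hP.1 hQ.1)
  rwa [star_add, hP.star_eq, hQ.star_eq] at h

/-- The parallelogram identity bounds `|P + z Q|²` by `2 (P + Q)` for `|z| = 1`. -/
theorem opTrace_star_mul_self_ne_top (hP : IsProj M P) (hQ : IsProj M Q)
    (hPt : opTrace τ P ≠ ∞) (hQt : opTrace τ Q ≠ ∞) {z : ℂ} (hz : star z * z = 1) :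
    opTrace τ (star (P + z • Q) * (P + z • Q)) ≠ ∞ := by
  have h1 : star (P + z • Q) * (P + z • Q) + star (P - z • Q) * (P - z • Q)
      = (P + Q) + (P + Q) := by
    have h2 : star (P + z • Q) * (P + z • Q) + star (P - z • Q) * (P - z • Q)
        = P * P + P * P + ((star z * z) • (Q * Q) + (star z * z) • (Q * Q)) := by
      simp only [star_add, star_sub, star_smul, hP.star_eq, hQ.star_eq, add_mul, mul_add, sub_mul,
        mul_sub, smul_mul_assoc, mul_smul_comm]
      module
    rw [h2, hz, one_smul, hP.mul_self, hQ.mul_self]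
    abel
  have h3 := congrArg (opTrace τ) h1
  have hPQ := add_mem hP.mem_posCone hQ.mem_posCone
  rw [opTrace_add (star_mul_self_mem_posCone (add_mem hP.1 (smul_mem_vN M z hQ.1)))
    (star_mul_self_mem_posCone (sub_mem hP.1 (smul_mem_vN M z hQ.1))), opTrace_add hPQ hPQ,
    opTrace_add hP.mem_posCone hQ.mem_posCone] at h3
  have h4 : opTrace τ P + opTrace τ Q ≠ ∞ := ENNReal.add_ne_top.2 ⟨hPt, hQt⟩
  have h5 : opTrace τ P + opTrace τ Q + (opTrace τ P + opTrace τ Q) ≠ ∞ :=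
    ENNReal.add_ne_top.2 ⟨h4, h4⟩
  rw [← h3] at h5
  exact (ENNReal.add_ne_top.1 h5).1

theorem opTrace_add_mul_self_ne_top (hP : IsProj M P) (hQ : IsProj M Q)
    (hPt : opTrace τ P ≠ ∞) (hQt : opTrace τ Q ≠ ∞) :
    opTrace τ ((P + Q) * (P + Q)) ≠ ∞ := by
  have h := opTrace_star_mul_self_ne_top hP hQ hPt hQt (z := 1) (by simp)
  rwa [one_smul, star_add, hP.star_eq, hQ.star_eq] at h

/-- `τ(P Q)` is the value of a decomposition of `P Q` into positive elements, read off from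
`2 P Q = (P + Q)² - (P + Q) + i (|P - i Q|² - (P + Q))`. -/
theorem exists_isTraceValue_mul (hP : IsProj M P) (hQ : IsProj M Q)
    (hPt : opTrace τ P ≠ ∞) (hQt : opTrace τ Q ≠ ∞) : ∃ z, IsTraceValue τ (P * Q) z := by
  have hS : (P + Q) ∈ posCone M := add_mem hP.mem_posCone hQ.mem_posCone
  have hSt : opTrace τ (P + Q) ≠ ∞ := by
    rw [opTrace_add hP.mem_posCone hQ.mem_posCone]
    exact ENNReal.add_ne_top.2 ⟨hPt, hQt⟩
  have hI := opTrace_star_mul_self_ne_top hP hQ hPt hQt (z := -Complex.I) (by simp)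
  have hIm := star_mul_self_mem_posCone (add_mem hP.1 (smul_mem_vN M (-Complex.I) hQ.1))
  set T := star (P + (-Complex.I) • Q) * (P + (-Complex.I) • Q) with hT
  have hU := opTrace_add_mul_self_ne_top hP hQ hPt hQt
  have hUm := hP.add_mul_self_mem_posCone hQ
  have half : ∀ {A : H →L[ℂ] H} (hA : A ∈ posCone M), opTrace τ A ≠ ∞ →
      τ ((1 / 2 : ℝ≥0) • ⟨A, hA⟩) < ∞ := by
    intro A hA hAt
    rw [opTrace_eq hA] at hAt
    rw [map_smul]
    exact ENNReal.mul_lt_top (by simp) hAt.lt_top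
  refine ⟨_, ![(1 / 2 : ℝ≥0) • ⟨_, hUm⟩, (1 / 2 : ℝ≥0) • ⟨_, hS⟩, (1 / 2 : ℝ≥0) • ⟨_, hIm⟩,
    (1 / 2 : ℝ≥0) • ⟨_, hS⟩], ?_, ?_, rfl⟩
  · intro j
    fin_cases j
    exacts [half hUm hU, half hS hSt, half hIm hI, half hS hSt]
  · have hco : ∀ {A : H →L[ℂ] H} (hA : A ∈ posCone M),
        (((1 / 2 : ℝ≥0) • (⟨A, hA⟩ : posCone M) : posCone M) : H →L[ℂ] H) = (1 / 2 : ℂ) • A := by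
      intro A hA
      have h : ∀ r : ℝ≥0, r • A = ((r : ℝ) : ℂ) • A := fun r => by
        ext x
        simp [NNReal.smul_def]
      refine (h (1 / 2)).trans ?_
      norm_num
    simp only [Matrix.cons_val]
    rw [hco, hco, hco, hT]
    simp only [star_add, star_smul, hP.star_eq, hQ.star_eq, add_mul, mul_add,
      smul_mul_assoc, mul_smul_comm, smul_smul, hP.mul_self, hQ.mul_self, smul_add, smul_sub,
      star_neg, Complex.star_def, Complex.conj_I]
    match_scalars <;> ring_nf
    all_goals norm_num [Complex.I_sq, Complex.I_pow_three]

/-- The real part of `τ(P Q)` determines the trace of `(P + Q)²`. -/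
theorem opTrace_add_mul_self_of_isTraceValue (hP : IsProj M P) (hQ : IsProj M Q)
    (hPt : opTrace τ P ≠ ∞) (hQt : opTrace τ Q ≠ ∞) {z : ℂ} (hz : IsTraceValue τ (P * Q) z) :
    (opTrace τ ((P + Q) * (P + Q))).toReal =
      (opTrace τ P).toReal + (opTrace τ Q).toReal + 2 * z.re := by
  obtain ⟨a, ha, hA, rfl⟩ := hz
  have hsa : ∀ x : posCone M, star (x : H →L[ℂ] H) = x := fun x =>
    (IsSelfAdjoint.of_nonneg x.2.2).star_eq
  have hst := congrArg star hA
  simp only [star_add, star_sub, star_smul, hsa, Complex.star_def, Complex.conj_I, star_mul,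
    hP.star_eq, hQ.star_eq] at hst
  have h1 : (P + Q) * (P + Q) + ((a 1 : H →L[ℂ] H) + a 1) = P + Q + ((a 0 : H →L[ℂ] H) + a 0) := by
    simp only [add_mul, mul_add, hP.mul_self, hQ.mul_self]
    rw [hA, hst]
    module
  have h2 := congrArg (fun A => (opTrace τ A).toReal) h1
  have hf : ∀ j, opTrace τ (a j : H →L[ℂ] H) = τ (a j) := fun j => opTrace_eq (a j).2
  have hfin : ∀ j, opTrace τ (a j : H →L[ℂ] H) ≠ ∞ := fun j => by
    rw [hf]
    exact (ha j).ne
  have hUm := hP.add_mul_self_mem_posCone hQ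
  rw [opTrace_add hUm (add_mem (a 1).2 (a 1).2), opTrace_add (a 1).2 (a 1).2,
    opTrace_add (add_mem hP.mem_posCone hQ.mem_posCone) (add_mem (a 0).2 (a 0).2),
    opTrace_add (a 0).2 (a 0).2, opTrace_add hP.mem_posCone hQ.mem_posCone,
    ENNReal.toReal_add (opTrace_add_mul_self_ne_top hP hQ hPt hQt)
      (ENNReal.add_ne_top.2 ⟨hfin 1, hfin 1⟩), ENNReal.toReal_add (hfin 1) (hfin 1),
    ENNReal.toReal_add (ENNReal.add_ne_top.2 ⟨hPt, hQt⟩) (ENNReal.add_ne_top.2 ⟨hfin 0, hfin 0⟩),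
    ENNReal.toReal_add (hfin 0) (hfin 0), ENNReal.toReal_add hPt hQt, hf, hf] at h2
  have h3 : ((((τ (a 0)).toReal - (τ (a 1)).toReal : ℝ) : ℂ) +
      Complex.I * (((τ (a 2)).toReal - (τ (a 3)).toReal : ℝ) : ℂ)).re =
      (τ (a 0)).toReal - (τ (a 1)).toReal := by simp
  rw [h3]
  linarith

/-- The trace of `(P + Q)²` in terms of that of `P Q P`, obtained from the invariance of the trace
under the reflection `2 P - 1`. -/
theorem opTrace_mul_mul (hτ : IsTrace τ) (hP : IsProj M P) (hQ : IsProj M Q) :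
    4 * opTrace τ (P * Q * P) + 2 * opTrace τ P + 2 * opTrace τ Q + opTrace τ Q =
      opTrace τ Q + 2 * opTrace τ ((P + Q) * (P + Q)) := by
  set u : H →L[ℂ] H := P + P - 1 with hu
  have huM : u ∈ M := sub_mem (add_mem hP.1 hP.1) (one_mem M)
  have hus : star u = u := by simp [hu, hP.star_eq]
  have huu : u * u = 1 := by
    simp only [hu, sub_mul, mul_sub, add_mul, mul_add, hP.mul_self, one_mul, mul_one]
    abel
  have h1 : opTrace τ (u * Q * u) = opTrace τ Q := by
    have h2 := opTrace_star_mul_self hτ (mul_mem hQ.1 huM)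
    rw [star_mul, hus, hQ.star_eq] at h2
    have e1 : u * Q * (Q * u) = u * Q * u := by
      rw [mul_assoc, ← mul_assoc Q, hQ.mul_self, ← mul_assoc]
    have e2 : Q * u * (u * Q) = Q := by
      rw [mul_assoc, ← mul_assoc u, huu, one_mul, hQ.mul_self]
    rwa [e1, e2] at h2
  have huQ : u * Q * u ∈ posCone M := by
    have h2 := star_mul_self_mem_posCone (mul_mem hQ.1 huM)
    rwa [star_mul, hus, hQ.star_eq, mul_assoc, ← mul_assoc Q, hQ.mul_self, ← mul_assoc] at h2
  have hX := hP.mul_mul_mem_posCone hQ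
  have hU := hP.add_mul_self_mem_posCone hQ
  have hPm := hP.mem_posCone
  have hQm := hQ.mem_posCone
  have key : ((P * Q * P + P * Q * P) + (P * Q * P + P * Q * P)) + (P + P) + (Q + Q) + Q =
      u * Q * u + ((P + Q) * (P + Q) + (P + Q) * (P + Q)) := by
    simp only [hu, sub_mul, mul_sub, add_mul, mul_add, hP.mul_self, hQ.mul_self, one_mul, mul_one]
    abel
  have h3 := congrArg (opTrace τ) key
  rw [opTrace_add (add_mem (add_mem (add_mem (add_mem hX hX) (add_mem hX hX)) (add_mem hPm hPm))
      (add_mem hQm hQm)) hQm,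
    opTrace_add (add_mem (add_mem (add_mem hX hX) (add_mem hX hX)) (add_mem hPm hPm))
      (add_mem hQm hQm),
    opTrace_add (add_mem (add_mem hX hX) (add_mem hX hX)) (add_mem hPm hPm),
    opTrace_add (add_mem hX hX) (add_mem hX hX), opTrace_add hX hX, opTrace_add hPm hPm,
    opTrace_add hQm hQm, opTrace_add huQ (add_mem hU hU), opTrace_add hU hU, h1] at h3
  rw [two_mul, two_mul, two_mul, ← h3]
  ring

/-- For projections of equal finite trace, orthogonality is detected by the trace of `(P + Q)²`. -/
theorem mul_eq_zero_iff_opTrace (hτ : IsTrace τ) (hP : IsProj M P) (hQ : IsProj M Q)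
    (hPt : opTrace τ P ≠ ∞) (hQt : opTrace τ Q ≠ ∞) :
    P * Q = 0 ↔ opTrace τ ((P + Q) * (P + Q)) = opTrace τ P + opTrace τ Q := by
  constructor
  · intro h
    have h' := hP.mul_comm_of_eq_zero hQ h
    rw [← opTrace_add hP.mem_posCone hQ.mem_posCone]
    congr 1
    rw [add_mul, mul_add, mul_add, h, h', hP.mul_self, hQ.mul_self, add_zero, zero_add]
  · intro h
    have h1 := opTrace_mul_mul hτ hP hQ
    rw [h] at h1
    have h2 : 4 * opTrace τ (P * Q * P) + (2 * opTrace τ P + 2 * opTrace τ Q + opTrace τ Q) =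
        0 + (2 * opTrace τ P + 2 * opTrace τ Q + opTrace τ Q) := by
      rw [zero_add, ← add_assoc, ← add_assoc, h1]
      ring
    have h3 := (ENNReal.add_left_inj (by finiteness)).1 h2
    have h4 : opTrace τ (P * Q * P) = 0 := by simpa using h3
    have h5 := opTrace_eq_zero hτ (hP.mul_mul_mem_posCone hQ) h4
    have h6 : star (Q * P) * (Q * P) = 0 := by
      rw [star_mul, hP.star_eq, hQ.star_eq, mul_assoc, ← mul_assoc Q, hQ.mul_self, ← mul_assoc, h5]
    exact hQ.mul_comm_of_eq_zero hP (CStarRing.star_mul_self_eq_zero_iff _ |>.1 h6)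

/-- The squared Hilbert-Schmidt norm of `P + Q - R - S` in terms of the traces of `(P' + Q')²`,
where `P'`, `Q'` run through the four projections. -/
theorem opTrace_sub_mul_self (hP : IsProj M P) (hQ : IsProj M Q) (hR : IsProj M R)
    (hS : IsProj M S) :
    opTrace τ (star (P + Q - (R + S)) * (P + Q - (R + S))) +
      (opTrace τ ((P + R) * (P + R)) + opTrace τ ((P + S) * (P + S)) +
        (opTrace τ ((Q + R) * (Q + R)) + opTrace τ ((Q + S) * (Q + S)))) =
      opTrace τ ((P + Q) * (P + Q)) + opTrace τ ((R + S) * (R + S)) +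
        (opTrace τ P + opTrace τ Q + (opTrace τ R + opTrace τ S) +
        (opTrace τ P + opTrace τ Q + (opTrace τ R + opTrace τ S))) := by
  have hX : P + Q - (R + S) ∈ M := sub_mem (add_mem hP.1 hQ.1) (add_mem hR.1 hS.1)
  have hPR := hP.add_mul_self_mem_posCone hR
  have hPS := hP.add_mul_self_mem_posCone hS
  have hQR := hQ.add_mul_self_mem_posCone hR
  have hQS := hQ.add_mul_self_mem_posCone hS
  have hPQ := hP.add_mul_self_mem_posCone hQ
  have hRS := hR.add_mul_self_mem_posCone hS
  have hPm := hP.mem_posCone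
  have hQm := hQ.mem_posCone
  have hRm := hR.mem_posCone
  have hSm := hS.mem_posCone
  rw [← opTrace_add hPR hPS, ← opTrace_add hQR hQS,
    ← opTrace_add (add_mem hPR hPS) (add_mem hQR hQS),
    ← opTrace_add (star_mul_self_mem_posCone hX) (add_mem (add_mem hPR hPS) (add_mem hQR hQS)),
    ← opTrace_add hPQ hRS, ← opTrace_add hPm hQm, ← opTrace_add hRm hSm,
    ← opTrace_add (add_mem hPm hQm) (add_mem hRm hSm),
    ← opTrace_add (add_mem (add_mem hPm hQm) (add_mem hRm hSm))
      (add_mem (add_mem hPm hQm) (add_mem hRm hSm)),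
    ← opTrace_add (add_mem hPQ hRS) (add_mem (add_mem (add_mem hPm hQm) (add_mem hRm hSm))
      (add_mem (add_mem hPm hQm) (add_mem hRm hSm)))]
  congr 1
  simp only [star_add, star_sub, hP.star_eq, hQ.star_eq, hR.star_eq, hS.star_eq, sub_mul, mul_sub,
    add_mul, mul_add, hP.mul_self, hQ.mul_self, hR.mul_self, hS.mul_self]
  abel

end TransitionProbability
end

/-! ### Algebraic relations between projections -/

section Algebra

variable {A : Type*} [CStarAlgebra A]

/-- Three differences `aᵢ - bᵢ` that agree, with `aᵢ` orthogonal to `bⱼ` for `i ≠ j`, force the `aᵢ`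
to commute. This fails for two indices. -/
theorem commute_of_sub_eq_sub {a₁ a₂ a₃ b₁ b₂ b₃ : A} (ha₁ : IsStarProjection a₁)
    (ha₂ : star a₂ = a₂) (ha₃ : star a₃ = a₃) (hb₃ : star b₃ = b₃)
    (h₁₂ : a₁ * b₂ = 0) (h₁₃ : a₁ * b₃ = 0) (h₂₁ : a₂ * b₁ = 0) (h₂₃ : a₂ * b₃ = 0)
    (h₃₁ : a₃ * b₁ = 0) (h₃₂ : a₃ * b₂ = 0) (h₂ : a₁ - a₂ = b₁ - b₂) (h₃ : a₁ - a₃ = b₁ - b₃) :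
    a₁ * a₃ = a₃ * a₁ ∧ a₁ * b₁ = a₁ - a₁ * a₃ ∧ b₁ * a₁ = a₁ - a₁ * a₃ := by
  have hs₁ : star a₁ = a₁ := ha₁.isSelfAdjoint.star_eq
  have hi₁ : a₁ * a₁ = a₁ := ha₁.isIdempotentElem
  have h₄ : a₂ - a₃ = b₂ - b₃ := by
    rw [← sub_sub_sub_cancel_left a₃ a₂ a₁, h₃, h₂]
    abel
  have e₁ : a₁ * a₂ = a₁ * a₃ := by
    rw [← sub_eq_zero, ← mul_sub, h₄, mul_sub, h₁₂, h₁₃, sub_zero]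
  have e₂ : a₂ * a₁ = a₂ * a₃ := by
    rw [← sub_eq_zero, ← mul_sub, h₃, mul_sub, h₂₁, h₂₃, sub_zero]
  have e₃ : a₃ * a₁ = a₃ * a₂ := by
    rw [← sub_eq_zero, ← mul_sub, h₂, mul_sub, h₃₁, h₃₂, sub_zero]
  have e₂' : a₁ * a₂ = a₃ * a₂ := by
    simpa [hs₁, ha₂, ha₃] using congrArg star e₂
  have hcomm : a₁ * a₃ = a₃ * a₁ := by rw [← e₁, e₂', e₃]
  have hb : b₁ = a₁ - a₃ + b₃ := by rw [h₃, sub_add_cancel]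
  have h₁₃' : b₃ * a₁ = 0 := by simpa [hs₁, hb₃] using congrArg star h₁₃
  refine ⟨hcomm, ?_, ?_⟩
  · rw [hb, mul_add, mul_sub, hi₁, h₁₃, add_zero]
  · rw [hb, add_mul, sub_mul, hi₁, h₁₃', add_zero, hcomm]

variable [PartialOrder A] [StarOrderedRing A]

/-- If the difference of two projections `v - v'` equals that of two commuting projections
`a - a'`, then `v` dominates its positive part `a - a a'`. -/
theorem mul_sub_mul_eq {a a' v v' : A} (ha : IsStarProjection a) (ha' : IsStarProjection a')
    (hv : IsStarProjection v) (hv' : IsStarProjection v') (hcomm : a * a' = a' * a)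
    (h : a - a' = v - v') : v * (a - a * a') = a - a * a' := by
  set g := a - a * a' with hg
  have hgs : star g = g := by
    simp [hg, ha.isSelfAdjoint.star_eq, ha'.isSelfAdjoint.star_eq, hcomm]
  have hi : a * a = a := ha.isIdempotentElem
  have hi' : a' * a' = a' := ha'.isIdempotentElem
  have hDg : (a - a') * g = g := by
    have h1 : a' * (a * a') = a * a' := by rw [← mul_assoc, ← hcomm, mul_assoc, hi']
    rw [hg, sub_mul, mul_sub, mul_sub, hi, ← mul_assoc, hi, h1, ← hcomm]
    abel
  -- `⟨v h, h⟩ = ‖h‖² + ‖v' h‖²` on the range of `g`, while `v ≤ 1`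
  have hsum : star (v' * g) * (v' * g) + star ((1 - v) * g) * ((1 - v) * g) = 0 := by
    have h1 : ∀ {w : A}, IsStarProjection w → star (w * g) * (w * g) = g * (w * g) := by
      intro w hw
      rw [star_mul, hgs, hw.isSelfAdjoint.star_eq, mul_assoc, ← mul_assoc w w,
        hw.isIdempotentElem.eq]
    have h2 : (1 - (a - a')) * g = 0 := by rw [sub_mul, hDg, one_mul, sub_self]
    rw [h1 hv', h1 hv.one_sub, ← mul_add, ← add_mul,
      show v' + (1 - v) = 1 - (a - a') by rw [h]; abel, h2, mul_zero]
  have h0 : star ((1 - v) * g) * ((1 - v) * g) = 0 :=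
    ((add_eq_zero_iff_of_nonneg (star_mul_self_nonneg _) (star_mul_self_nonneg _)).1 hsum).2
  rw [CStarRing.star_mul_self_eq_zero_iff, sub_mul, one_mul, sub_eq_zero] at h0
  exact h0.symm

end Algebra

section
variable {H : Type*} [NormedAddCommGroup H] [InnerProductSpace ℂ H] [CompleteSpace H]
variable {M : VonNeumannAlgebra H} {τ : posCone M →ₗ[ℝ≥0] ℝ≥0∞}

/-! ### Maps that preserve orthogonality and sums -/

/-- The projections of `M` of trace `C`, as a predicate on operators. -/
def HasProjTrace (τ : posCone M →ₗ[ℝ≥0] ℝ≥0∞) (C : ℝ≥0∞) (A : H →L[ℂ] H) : Prop :=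
  IsProj M A ∧ opTrace τ A = C

/-- A map on operators that sends projections of trace `C` to projections, and preserves
orthogonality and the additive relations between two pairs of projections of trace `C`. -/
structure IsOrthoAdditive (τ : posCone M →ₗ[ℝ≥0] ℝ≥0∞) (C : ℝ≥0∞)
    (f : (H →L[ℂ] H) → (H →L[ℂ] H)) : Prop where
  isProj : ∀ {P}, HasProjTrace τ C P → IsProj M (f P)
  orth : ∀ {P Q}, HasProjTrace τ C P → HasProjTrace τ C Q → P * Q = 0 → f P * f Q = 0
  add : ∀ {P Q R S}, HasProjTrace τ C P → HasProjTrace τ C Q → HasProjTrace τ C R →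
    HasProjTrace τ C S → P + Q = R + S → f P + f Q = f R + f S

/-- Pairwise orthogonal projections `E, E', F, F'` orthogonal to `Y`, with `τ(E) = τ(E')` and
`τ(F) = τ(F')`, such that `E + F` has trace `C`. Then `E + F` and `E + F'` are commuting projections
of trace `C` with product `E`. -/
structure IsFrame (τ : posCone M →ₗ[ℝ≥0] ℝ≥0∞) (C : ℝ≥0∞) (Y E E' F F' : H →L[ℂ] H) :
    Prop where
  hE : IsProj M E
  hE' : IsProj M E'
  hF : IsProj M F
  hF' : IsProj M F'
  EE' : E * E' = 0
  EF : E * F = 0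
  EF' : E * F' = 0
  E'F : E' * F = 0
  E'F' : E' * F' = 0
  FF' : F * F' = 0
  YE : Y * E = 0
  YE' : Y * E' = 0
  YF : Y * F = 0
  YF' : Y * F' = 0
  traceE : opTrace τ E' = opTrace τ E
  traceF : opTrace τ F' = opTrace τ F
  trace : opTrace τ E + opTrace τ F = C

theorem HasProjTrace.add {C : ℝ≥0∞} {A B : H →L[ℂ] H} (hA : IsProj M A) (hB : IsProj M B)
    (h : A * B = 0) (ht : opTrace τ A + opTrace τ B = C) : HasProjTrace τ C (A + B) :=
  ⟨hA.add hB h, by rw [opTrace_add hA.mem_posCone hB.mem_posCone, ht]⟩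

/-- If `E` is equivalent to some `y ≤ Y`, then the three projections `E, E', y` are available for
`commute_of_sub_eq_sub`. -/
theorem IsOrthoAdditive.frame_of_le {C : ℝ≥0∞} {f : (H →L[ℂ] H) → (H →L[ℂ] H)}
    (hf : IsOrthoAdditive τ C f) {Y E E' F F' V y : H →L[ℂ] H} (hY : IsProj M Y)
    (h : IsFrame τ C Y E E' F F') (hV : HasProjTrace τ C V) (hVE : V * E = E) (hVY : V * Y = 0)
    (hy : IsProj M y) (hYy : Y * y = y) (hyt : opTrace τ y = opTrace τ E) :
    f (E + F) * f (E + F') = f (E + F') * f (E + F) ∧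
      f V * (f (E + F) * f (E + F')) = f (E + F) * f (E + F') := by
  have hyY := hY.mul_comm_of_eq_right hy hYy
  have hyX : ∀ {X}, Y * X = 0 → y * X = 0 := fun {X} hX => by
    rw [← hyY, mul_assoc, hX, mul_zero]
  have hyE := hyX h.YE
  have hyE' := hyX h.YE'
  have hyF := hyX h.YF
  have hyF' := hyX h.YF'
  have hVy : V * y = 0 := by rw [← hYy, ← mul_assoc, hVY, zero_mul]
  have E'E := h.hE.mul_comm_of_eq_zero h.hE' h.EE'
  have FE := h.hE.mul_comm_of_eq_zero h.hF h.EF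
  have FE' := h.hE'.mul_comm_of_eq_zero h.hF h.E'F
  have Ey := hy.mul_comm_of_eq_zero h.hE hyE
  have E'y := hy.mul_comm_of_eq_zero h.hE' hyE'
  have Fy := hy.mul_comm_of_eq_zero h.hF hyF
  have tEF' : opTrace τ E + opTrace τ F' = C := by rw [h.traceF, h.trace]
  have g₁ : HasProjTrace τ C (E + F) := .add h.hE h.hF h.EF h.trace
  have g₂ : HasProjTrace τ C (E' + F) := .add h.hE' h.hF h.E'F (by rw [h.traceE, h.trace])
  have g₃ : HasProjTrace τ C (y + F) := .add hy h.hF hyF (by rw [hyt, h.trace])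
  have k₁ : HasProjTrace τ C (E + F') := .add h.hE h.hF' h.EF' tEF'
  have k₂ : HasProjTrace τ C (E' + F') := .add h.hE' h.hF' h.E'F' (by rw [h.traceE, tEF'])
  have k₃ : HasProjTrace τ C (y + F') := .add hy h.hF' hyF' (by rw [hyt, tEF'])
  have orth : ∀ {A B : H →L[ℂ] H}, HasProjTrace τ C (A + F) → HasProjTrace τ C (B + F') →
      A * B = 0 → A * F' = 0 → F * B = 0 → f (A + F) * f (B + F') = 0 := by
    intro A B hA hB h1 h2 h3
    refine hf.orth hA hB ?_
    rw [add_mul, mul_add, mul_add, h1, h2, h3, h.FF']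
    simp
  have sub : ∀ {A B : H →L[ℂ] H}, HasProjTrace τ C (A + F) → HasProjTrace τ C (B + F) →
      HasProjTrace τ C (A + F') → HasProjTrace τ C (B + F') →
      f (A + F) - f (B + F) = f (A + F') - f (B + F') := by
    intro A B h1 h2 h3 h4
    have h5 := hf.add h1 h4 h3 h2 (by abel)
    rw [sub_eq_sub_iff_add_eq_add, h5]
  obtain ⟨hc, h1, h2⟩ := commute_of_sub_eq_sub (hf.isProj g₁).2 (hf.isProj g₂).star_eq
    (hf.isProj g₃).star_eq (hf.isProj k₃).star_eq
    (orth g₁ k₂ h.EE' h.EF' FE') (orth g₁ k₃ Ey h.EF' Fy) (orth g₂ k₁ E'E h.E'F' FE)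
    (orth g₂ k₃ E'y h.E'F' Fy) (orth g₃ k₁ hyE hyF' FE) (orth g₃ k₂ hyE' hyF' FE')
    (sub g₁ g₂ k₁ k₂) (sub g₁ g₃ k₁ k₃)
  refine ⟨by rw [h1, h2], ?_⟩
  have hVEy : (V - E) * y = 0 := by rw [sub_mul, hVy, Ey, sub_zero]
  have hV' : HasProjTrace τ C (V - E + y) := by
    refine .add (hV.1.sub h.hE hVE) hy hVEy ?_
    rw [hyt, opTrace_sub_add hV.1 h.hE hVE, hV.2]
  have h3 : f (E + F) - f (y + F) = f V - f (V - E + y) := by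
    have h5 := hf.add g₁ hV' hV g₃ (by abel)
    rw [sub_eq_sub_iff_add_eq_add, h5]
  rw [h1]
  exact mul_sub_mul_eq (hf.isProj g₁).2 (hf.isProj g₃).2 (hf.isProj hV).2 (hf.isProj hV').2 hc h3

/-- The images of `E + F` and `E + F'` commute, and `f V` dominates their product whenever `V`
dominates `E`. For large `E`, a part `A` of `E` equivalent to `Y` is split off, and the relation
`(E + F') + (E' + F') = (A + B' + F') + (A' + B + F')` with `B = E - A` and `B' = E' - A'` writes the
product for `E` as the sum of those for `A` and `B`; here `n` bounds the number of such parts. -/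
theorem IsOrthoAdditive.frame (hM : IsFactor M) (hτ : IsTrace τ) {C : ℝ≥0∞} (hC : C ≠ ∞)
    {f : (H →L[ℂ] H) → (H →L[ℂ] H)} (hf : IsOrthoAdditive τ C f) {Y V : H →L[ℂ] H}
    (hY : IsProj M Y) (hV : HasProjTrace τ C V) (hVY : V * Y = 0) (n : ℕ) :
    ∀ {E E' F F' : H →L[ℂ] H}, IsFrame τ C Y E E' F F' → V * E = E →
      opTrace τ E ≤ n * opTrace τ Y →
      f (E + F) * f (E + F') = f (E + F') * f (E + F) ∧
        f V * (f (E + F) * f (E + F')) = f (E + F) * f (E + F') := by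
  induction n with
  | zero =>
    intro E E' F F' h hVE hE
    refine hf.frame_of_le hY h hV hVE hVY (y := 0) ⟨zero_mem M, .zero _⟩ (mul_zero _) ?_
    have hE0 : opTrace τ E = 0 := by simpa using hE
    rw [opTrace_zero, hE0]
  | succ n ih =>
    intro E E' F F' h hVE hE
    rcases hM.comparison hτ h.hE hY with ⟨y, hy, hYy, hyt⟩ | ⟨A, hA, hEA, hAt⟩
    · exact hf.frame_of_le hY h hV hVE hVY hy hYy hyt
    have htA : opTrace τ (E - A) + opTrace τ A = opTrace τ E := opTrace_sub_add h.hE hA hEA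
    obtain ⟨A', hA', hEA', hAt'⟩ := hM.exists_isProj_le hτ hA h.hE'
      (by rw [h.traceE, ← htA]; exact le_add_self)
    have htA' : opTrace τ (E' - A') + opTrace τ A' = opTrace τ E' :=
      opTrace_sub_add h.hE' hA' hEA'
    have hfin : opTrace τ A ≠ ∞ := by
      rintro h0
      rw [← h.trace, ← htA, h0] at hC
      simp at hC
    have htB : opTrace τ (E' - A') = opTrace τ (E - A) := by
      rw [h.traceE, ← htA, hAt'] at htA'
      exact (ENNReal.add_left_inj hfin).1 htA'
    have hB := h.hE.sub hA hEA
    have hB' := h.hE'.sub hA' hEA'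
    have hAE := h.hE.mul_comm_of_eq_right hA hEA
    have hAE' := h.hE'.mul_comm_of_eq_right hA' hEA'
    set B := E - A with hBdef
    set B' := E' - A' with hBdef'
    have hEB : E * B = B := by rw [hBdef, mul_sub, h.hE.mul_self, hEA]
    have hEB' : E' * B' = B' := by rw [hBdef', mul_sub, h.hE'.mul_self, hEA']
    have hBE := h.hE.mul_comm_of_eq_right hB hEB
    have hBE' := h.hE'.mul_comm_of_eq_right hB' hEB'
    have hAB : A * B = 0 := by rw [hBdef, mul_sub, hAE, hA.mul_self, sub_self]
    have hAB' : A' * B' = 0 := by rw [hBdef', mul_sub, hAE', hA'.mul_self, sub_self]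
    have hBA := hA.mul_comm_of_eq_zero hB hAB
    have hBA' := hA'.mul_comm_of_eq_zero hB' hAB'
    -- products of subprojections of orthogonal projections vanish
    have left : ∀ {G G' X : H →L[ℂ] H}, G' * G = G' → G * X = 0 → G' * X = 0 :=
      fun h1 h2 => by rw [← h1, mul_assoc, h2, mul_zero]
    have right : ∀ {G G' X : H →L[ℂ] H}, G * G' = G' → X * G = 0 → X * G' = 0 :=
      fun h1 h2 => by rw [← h1, ← mul_assoc, h2, zero_mul]
    have tAB : opTrace τ B + opTrace τ F + opTrace τ A = C := by
      rw [← h.trace, ← htA]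
      ring
    have frA : IsFrame τ C Y A A' (B + F) (B' + F') := by
      refine ⟨hA, hA', hB.add h.hF (left hBE h.EF), hB'.add h.hF' (left hBE' h.E'F'),
        left hAE (right hEA' h.EE'), ?_, ?_, ?_, ?_, ?_, right hEA h.YE, right hEA' h.YE', ?_, ?_,
        hAt', ?_, ?_⟩
      · rw [mul_add, hAB, left hAE h.EF, add_zero]
      · rw [mul_add, left hAE (right hEB' h.EE'), left hAE h.EF', add_zero]
      · rw [mul_add, left hAE' (right hEB (h.hE.mul_comm_of_eq_zero h.hE' h.EE')),
          left hAE' h.E'F, add_zero]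
      · rw [mul_add, hAB', left hAE' h.E'F', add_zero]
      · rw [add_mul, mul_add, mul_add, left hBE (right hEB' h.EE'), left hBE h.EF', h.FF',
          right hEB' (h.hE'.mul_comm_of_eq_zero h.hF h.E'F)]
        simp
      · rw [mul_add, right hEB h.YE, h.YF, add_zero]
      · rw [mul_add, right hEB' h.YE', h.YF', add_zero]
      · rw [opTrace_add hB.mem_posCone h.hF.mem_posCone, opTrace_add hB'.mem_posCone
          h.hF'.mem_posCone, htB, h.traceF]
      · rw [opTrace_add hB.mem_posCone h.hF.mem_posCone, add_comm, tAB]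
    have frB : IsFrame τ C Y B B' (A + F) (A' + F') := by
      refine ⟨hB, hB', hA.add h.hF (left hAE h.EF), hA'.add h.hF' (left hAE' h.E'F'),
        left hBE (right hEB' h.EE'), ?_, ?_, ?_, ?_, ?_, right hEB h.YE, right hEB' h.YE', ?_, ?_,
        htB, ?_, ?_⟩
      · rw [mul_add, hBA, left hBE h.EF, add_zero]
      · rw [mul_add, left hBE (right hEA' h.EE'), left hBE h.EF', add_zero]
      · rw [mul_add, left hBE' (right hEA (h.hE.mul_comm_of_eq_zero h.hE' h.EE')),
          left hBE' h.E'F, add_zero]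
      · rw [mul_add, hBA', left hBE' h.E'F', add_zero]
      · rw [add_mul, mul_add, mul_add, left hAE (right hEA' h.EE'), left hAE h.EF', h.FF',
          right hEA' (h.hE'.mul_comm_of_eq_zero h.hF h.E'F)]
        simp
      · rw [mul_add, right hEA h.YE, h.YF, add_zero]
      · rw [mul_add, right hEA' h.YE', h.YF', add_zero]
      · rw [opTrace_add hA.mem_posCone h.hF.mem_posCone, opTrace_add hA'.mem_posCone
          h.hF'.mem_posCone, hAt', h.traceF]
      · rw [opTrace_add hA.mem_posCone h.hF.mem_posCone, ← tAB]
        ring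
    have hB_le : opTrace τ B ≤ n * opTrace τ Y := by
      rw [← htA, ← hAt, Nat.cast_add, Nat.cast_one, add_mul, one_mul] at hE
      rw [← hAt]
      exact (ENNReal.add_le_add_iff_right hfin).1 hE
    obtain ⟨cA, vA⟩ := hf.frame_of_le hY frA hV (by rw [← hEA, ← mul_assoc, hVE]) hVY hY hY.mul_self
      hAt.symm
    obtain ⟨cB, vB⟩ := ih frB (by rw [← hEB, ← mul_assoc, hVE]) hB_le
    have e₁ : A + (B + F) = E + F := by rw [hBdef]; abel
    have e₂ : B + (A + F) = E + F := by rw [hBdef]; abel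
    have tEF' : opTrace τ E + opTrace τ F' = C := by rw [h.traceF, h.trace]
    have tAr : opTrace τ A + opTrace τ (B' + F') = C := by rw [frA.traceF, frA.trace]
    have tBr : opTrace τ B + opTrace τ (A' + F') = C := by rw [frB.traceF, frB.trace]
    have g : HasProjTrace τ C (E + F) := .add h.hE h.hF h.EF h.trace
    have k : HasProjTrace τ C (E + F') := .add h.hE h.hF' h.EF' tEF'
    have k' : HasProjTrace τ C (E' + F') := .add h.hE' h.hF' h.E'F' (by rw [h.traceE, tEF'])
    have kA : HasProjTrace τ C (A + (B' + F')) := .add hA frA.hF' frA.EF' tAr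
    have kB : HasProjTrace τ C (B + (A' + F')) := .add hB frB.hF' frB.EF' tBr
    have horth : f (E + F) * f (E' + F') = 0 := by
      refine hf.orth g k' ?_
      rw [add_mul, mul_add, mul_add, h.EE', h.EF', h.FF', h.hE'.mul_comm_of_eq_zero h.hF h.E'F]
      simp
    have horth' := (hf.isProj g).mul_comm_of_eq_zero (hf.isProj k') horth
    have hadd : f (E + F') = f (A + (B' + F')) + f (B + (A' + F')) - f (E' + F') := by
      rw [eq_sub_iff_add_eq]
      exact hf.add k k' kA kB (by rw [hBdef, hBdef']; abel)
    rw [e₁] at cA vA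
    rw [e₂] at cB vB
    have hmul : f (E + F) * f (E + F') =
        f (E + F) * f (A + (B' + F')) + f (E + F) * f (B + (A' + F')) := by
      rw [hadd, mul_sub, mul_add, horth, sub_zero]
    have hmul' : f (E + F') * f (E + F) =
        f (A + (B' + F')) * f (E + F) + f (B + (A' + F')) * f (E + F) := by
      rw [hadd, sub_mul, add_mul, horth', sub_zero]
    exact ⟨by rw [hmul, hmul', cA, cB], by rw [hmul, mul_add, vA, vB]⟩

/-! ### Joins of commuting projections -/

/-- If `P₁, P₂, Q` have trace `C < τ(1) / 2`, `P₁` and `P₂` commute and `Q` lies under their join,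
then the image of `Q` lies under every upper bound `J` of the images of `P₁` and `P₂`. -/
theorem IsOrthoAdditive.mul_eq_of_le (hM : IsFactor M) (hτ : IsTrace τ) {C : ℝ≥0∞} (hC : C ≠ ∞)
    {f : (H →L[ℂ] H) → (H →L[ℂ] H)} (hf : IsOrthoAdditive τ C f)
    (hC1 : C + C < opTrace τ (1 : H →L[ℂ] H)) {P₁ P₂ Q J : H →L[ℂ] H}
    (h₁ : HasProjTrace τ C P₁) (h₂ : HasProjTrace τ C P₂) (hQ : HasProjTrace τ C Q)
    (hcomm : P₁ * P₂ = P₂ * P₁) (hle : (P₁ + P₂ - P₁ * P₂) * Q = Q)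
    (hJ₁ : J * f P₁ = f P₁) (hJ₂ : J * f P₂ = f P₂) : J * f Q = f Q := by
  set E := P₁ * P₂ with hE_def
  have hE : IsProj M E := h₁.1.mul h₂.1 hcomm
  have hP₁E : P₁ * E = E := by rw [hE_def, ← mul_assoc, h₁.1.mul_self]
  have hP₂E : P₂ * E = E := by rw [hcomm, ← mul_assoc, h₂.1.mul_self]
  have hEP₁ := h₁.1.mul_comm_of_eq_right hE hP₁E
  have hEP₂ := h₂.1.mul_comm_of_eq_right hE hP₂E
  have hF₁ : IsProj M (P₁ - E) := h₁.1.sub hE hP₁E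
  have hF₂ : IsProj M (P₂ - E) := h₂.1.sub hE hP₂E
  have hEF₁ : E * (P₁ - E) = 0 := by rw [mul_sub, hEP₁, hE.mul_self, sub_self]
  have hEF₂ : E * (P₂ - E) = 0 := by rw [mul_sub, hEP₂, hE.mul_self, sub_self]
  have hFF : (P₁ - E) * (P₂ - E) = 0 := by
    rw [sub_mul, hEF₂, mul_sub, hP₁E, ← hE_def, sub_self, sub_zero]
  set F₁ := P₁ - E with hF₁_def
  set F₂ := P₂ - E with hF₂_def
  have e₁ : E + F₁ = P₁ := add_sub_cancel _ _
  have e₂ : E + F₂ = P₂ := add_sub_cancel _ _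
  have hN : IsProj M (E + F₁ + F₂) :=
    (hE.add hF₁ hEF₁).add hF₂ (by rw [add_mul, hEF₂, hFF, add_zero])
  have hNe : P₁ + P₂ - E = E + F₁ + F₂ := by rw [← e₁, ← e₂]; abel
  rw [hNe] at hle
  set N := E + F₁ + F₂ with hN_def
  have hF₁E := hE.mul_comm_of_eq_zero hF₁ hEF₁
  have hF₂E := hE.mul_comm_of_eq_zero hF₂ hEF₂
  have hFF' := hF₁.mul_comm_of_eq_zero hF₂ hFF
  have hNE : N * E = E := by rw [hN_def, add_mul, add_mul, hE.mul_self, hF₁E, hF₂E]; simp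
  have hNF₁ : N * F₁ = F₁ := by rw [hN_def, add_mul, add_mul, hEF₁, hF₁.mul_self, hFF']; simp
  have hNF₂ : N * F₂ = F₂ := by rw [hN_def, add_mul, add_mul, hEF₂, hF₂.mul_self, hFF]; simp
  have tE₁ : opTrace τ E + opTrace τ F₁ = C := by
    rw [add_comm, ← h₁.2, ← opTrace_sub_add h₁.1 hE hP₁E]
  have tE₂ : opTrace τ E + opTrace τ F₂ = C := by
    rw [add_comm, ← h₂.2, ← opTrace_sub_add h₂.1 hE hP₂E]
  have hEfin : opTrace τ E ≠ ∞ := fun h0 => hC (by rw [← tE₁, h0, top_add])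
  have tF : opTrace τ F₁ = opTrace τ F₂ := by
    rw [← tE₂] at tE₁
    exact (ENNReal.add_right_inj hEfin).1 tE₁
  have tN : opTrace τ N = C + opTrace τ F₁ := by
    rw [hN_def, opTrace_add (hE.add hF₁ hEF₁).mem_posCone hF₂.mem_posCone,
      opTrace_add hE.mem_posCone hF₁.mem_posCone, tE₁, tF]
  have one_isProj : IsProj M (1 : H →L[ℂ] H) := ⟨one_mem M, .one _⟩
  have t1 : opTrace τ (1 - N) + opTrace τ N = opTrace τ (1 : H →L[ℂ] H) :=
    opTrace_sub_add one_isProj hN (one_mul _)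
  -- the complement of the join is large enough for an orthogonal copy of `E`
  have hlt : opTrace τ E ≤ opTrace τ (1 - N) := by
    by_contra! h0
    refine absurd hC1 (not_lt.2 ?_)
    calc opTrace τ (1 : H →L[ℂ] H) = opTrace τ (1 - N) + opTrace τ N := t1.symm
      _ ≤ opTrace τ E + opTrace τ N := by gcongr
      _ = C + C := by rw [tN, add_left_comm, tE₁]
  obtain ⟨E', hE', hNE', tE'⟩ := hM.exists_isProj_le hτ hE hN.one_sub hlt
  have hNE'0 : N * E' = 0 := by
    rw [← hNE', ← mul_assoc, mul_sub, mul_one, hN.mul_self, sub_self, zero_mul]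
  have hE'N := hN.mul_comm_of_eq_zero hE' hNE'0
  have hE'X : ∀ {X}, N * X = X → E' * X = 0 := fun {X} hX => by
    rw [← hX, ← mul_assoc, hE'N, zero_mul]
  have hE'E := hE'X hNE
  have hE'F₁ := hE'X hNF₁
  have hE'F₂ := hE'X hNF₂
  have hEE' := hE'.mul_comm_of_eq_zero hE hE'E
  have hW : IsProj M (N + E') := hN.add hE' hNE'0
  set W := N + E' with hW_def
  have hWQ : W * Q = Q := by rw [hW_def, add_mul, hle, hE'X hle, add_zero]
  have hWE' : W * E' = E' := by rw [hW_def, add_mul, hNE'0, hE'.mul_self, zero_add]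
  have hWX : ∀ {X}, N * X = X → W * X = X := fun {X} hX => by
    rw [hW_def, add_mul, hX, hE'X hX, add_zero]
  have tW : opTrace τ W = C + C := by
    rw [hW_def, opTrace_add hN.mem_posCone hE'.mem_posCone, tN, tE', add_assoc, add_comm
      (opTrace τ F₁), tE₁]
  have tY : opTrace τ (1 - W) ≠ 0 := by
    intro h0
    have h3 := opTrace_sub_add (τ := τ) one_isProj hW (one_mul _)
    rw [h0, zero_add, tW] at h3
    exact hC1.ne h3
  have hV : HasProjTrace τ C (W - Q) := by
    refine ⟨hW.sub hQ.1 hWQ, ?_⟩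
    have h3 := opTrace_sub_add (τ := τ) hW hQ.1 hWQ
    rw [hQ.2, tW] at h3
    exact (ENNReal.add_left_inj hC).1 h3
  have hQN := hN.mul_comm_of_eq_right hQ.1 hle
  have hQE' : Q * E' = 0 := by rw [← hQN, mul_assoc, hNE'0, mul_zero]
  have hYX : ∀ {X}, W * X = X → (1 - W) * X = 0 := fun {X} hX => by
    rw [sub_mul, one_mul, hX, sub_self]
  have hframe : IsFrame τ C (1 - W) E' E F₁ F₂ :=
    ⟨hE', hE, hF₁, hF₂, hE'E, hE'F₁, hE'F₂, hEF₁, hEF₂, hFF, hYX hWE', hYX (hWX hNE),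
      hYX (hWX hNF₁), hYX (hWX hNF₂), tE'.symm, tF.symm, by rw [tE', tE₁]⟩
  have hVW : W * (W - Q) = W - Q := by rw [mul_sub, hW.mul_self, hWQ]
  have hVY : (W - Q) * (1 - W) = 0 := by
    rw [mul_sub, mul_one, hW.mul_comm_of_eq_right hV.1 hVW, sub_self]
  obtain ⟨n, hn⟩ := ENNReal.exists_nat_mul_gt tY (tE' ▸ hEfin)
  obtain ⟨hc, hd⟩ := hf.frame hM hτ hC hW.one_sub hV hVY n hframe
    (by rw [sub_mul, hWE', hQE', sub_zero]) hn.le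
  have k₁ : HasProjTrace τ C (E' + F₁) := .add hE' hF₁ hE'F₁ (by rw [tE', tE₁])
  have k₂ : HasProjTrace τ C (E' + F₂) := .add hE' hF₂ hE'F₂ (by rw [tE', tE₂])
  have s₁ : f P₁ + f (E' + F₂) = f Q + f (W - Q) :=
    hf.add h₁ k₂ hQ hV (by rw [hW_def, hN_def, ← e₁]; abel)
  have s₂ : f P₂ + f (E' + F₁) = f Q + f (W - Q) :=
    hf.add h₂ k₁ hQ hV (by rw [hW_def, hN_def, ← e₂]; abel)
  have o₁ : f P₁ * f (E' + F₂) = 0 := hf.orth h₁ k₂ (by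
    rw [← e₁, add_mul, mul_add, mul_add, hEE', hEF₂, hFF, hE'.mul_comm_of_eq_zero hF₁ hE'F₁]; simp)
  have o₂ : f P₂ * f (E' + F₁) = 0 := hf.orth h₂ k₁ (by
    rw [← e₂, add_mul, mul_add, mul_add, hEE', hEF₁, hFF', hE'.mul_comm_of_eq_zero hF₂ hE'F₂]; simp)
  have oQ : f Q * f (W - Q) = 0 := hf.orth hQ hV (by
    rw [mul_sub, hW.mul_comm_of_eq_right hQ.1 hWQ, hQ.1.mul_self, sub_self])
  have gQ := hf.isProj hQ
  have gV := hf.isProj hV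
  have g₁ := hf.isProj k₁
  have g₂ := hf.isProj k₂
  set p₁ := f P₁
  set p₂ := f P₂
  set q := f Q
  set v := f (W - Q)
  set r₁ := f (E' + F₁)
  set r₂ := f (E' + F₂)
  -- the join of `p₁` and `p₂` is the complement of `r₁ r₂` in `w = q + v`, and `q` misses `r₁ r₂`
  have hx : q * (r₁ * r₂) = 0 := by rw [← hd, ← mul_assoc, oQ, zero_mul]
  have hx' : r₁ * r₂ * q = 0 := gQ.mul_comm_of_eq_zero (g₁.mul g₂ hc) hx
  have hvq : v * q = 0 := gQ.mul_comm_of_eq_zero gV oQ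
  have hjoin : p₁ + p₂ - p₂ * p₁ = q + v - r₁ * r₂ := by
    have h3 : p₂ * (q + v) = p₂ := by
      rw [← s₂, mul_add, (hf.isProj h₂).mul_self, o₂, add_zero]
    have h4 : (q + v) * r₂ = r₂ := by rw [← s₁, add_mul, o₁, g₂.mul_self, zero_add]
    have h5 : p₂ * r₂ = r₂ - r₁ * r₂ := by rw [eq_sub_of_add_eq s₂, sub_mul, h4]
    have h6 : p₂ * p₁ = p₂ - (r₂ - r₁ * r₂) := by
      rw [eq_sub_of_add_eq s₁, mul_sub, h3, h5]
    rw [h6, ← s₁]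
    abel
  have hJ : J * (q + v - r₁ * r₂) = q + v - r₁ * r₂ := by
    rw [← hjoin, mul_sub, mul_add, hJ₁, hJ₂, ← mul_assoc, hJ₂]
  have hq : (q + v - r₁ * r₂) * q = q := by
    rw [sub_mul, add_mul, gQ.mul_self, hvq, hx', add_zero, sub_zero]
  calc J * q = J * ((q + v - r₁ * r₂) * q) := by rw [hq]
    _ = q := by rw [← mul_assoc, hJ, hq]

/-! ### Maps that preserve the transition probability -/

/-- A map that preserves the transition probability preserves the traces of the squares
`(P + Q)²`. -/
theorem PreservesTransitionProbability.opTrace_add_mul_self {c : ℝ}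
    {φ : Grassmann τ c → Grassmann τ c} (hφ : PreservesTransitionProbability τ φ)
    (P Q : Grassmann τ c) :
    opTrace τ (((φ P).1.op + (φ Q).1.op) * ((φ P).1.op + (φ Q).1.op)) =
      opTrace τ ((P.1.op + Q.1.op) * (P.1.op + Q.1.op)) := by
  have ht : ∀ R : Grassmann τ c, opTrace τ R.1.op = ENNReal.ofReal c := fun R =>
    (opTrace_toPos R.1).trans R.2
  have hfin : ∀ R : Grassmann τ c, opTrace τ R.1.op ≠ ∞ := fun R => by
    rw [ht]
    exact ENNReal.ofReal_ne_top
  have hp : ∀ R : Grassmann τ c, IsProj M R.1.op := fun R => R.1.isProj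
  obtain ⟨z, hz⟩ := exists_isTraceValue_mul (hp P) (hp Q) (hfin P) (hfin Q)
  obtain ⟨w, hw⟩ := exists_isTraceValue_mul (hp (φ P)) (hp (φ Q)) (hfin _) (hfin _)
  have h1 := hφ P Q
  rw [tr_eq hz, tr_eq hw] at h1
  rw [← ENNReal.toReal_eq_toReal_iff' (opTrace_add_mul_self_ne_top (hp _) (hp _) (hfin _) (hfin _))
    (opTrace_add_mul_self_ne_top (hp _) (hp _) (hfin _) (hfin _)),
    opTrace_add_mul_self_of_isTraceValue (hp _) (hp _) (hfin _) (hfin _) hz,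
    opTrace_add_mul_self_of_isTraceValue (hp _) (hp _) (hfin _) (hfin _) hw, h1]
  simp only [ht]

open Classical in
/-- A self-map of the Grassmann space as a map on operators, `0` off the projections of
trace `c`. -/
noncomputable def opMap {c : ℝ} (φ : Grassmann τ c → Grassmann τ c) (A : H →L[ℂ] H) : H →L[ℂ] H :=
  if h : ∃ P : Grassmann τ c, P.1.op = A then (φ h.choose).1.op else 0

theorem opMap_op {c : ℝ} (φ : Grassmann τ c → Grassmann τ c) (P : Grassmann τ c) :
    opMap φ P.1.op = (φ P).1.op := by
  have h : ∃ R : Grassmann τ c, R.1.op = P.1.op := ⟨P, rfl⟩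
  have h1 : h.choose = P := Subtype.ext (Subtype.ext h.choose_spec)
  rw [opMap, dif_pos h, h1]

theorem HasProjTrace.exists_eq {c : ℝ} {A : H →L[ℂ] H}
    (hA : HasProjTrace τ (ENNReal.ofReal c) A) : ∃ P : Grassmann τ c, P.1.op = A :=
  ⟨⟨⟨A, hA.1⟩, (opTrace_toPos (τ := τ) ⟨A, hA.1⟩).symm.trans hA.2⟩, rfl⟩

theorem hasProjTrace_op {c : ℝ} (P : Grassmann τ c) :
    HasProjTrace τ (ENNReal.ofReal c) P.1.op :=
  ⟨P.1.isProj, (opTrace_toPos P.1).trans P.2⟩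

/-- Preservation of the transition probability gives orthogonality, and additive relations through
the Hilbert-Schmidt norm of `P + Q - R - S`. -/
theorem PreservesTransitionProbability.isOrthoAdditive (hτ : IsTrace τ) {c : ℝ}
    {φ : Grassmann τ c → Grassmann τ c} (hφ : PreservesTransitionProbability τ φ) :
    IsOrthoAdditive τ (ENNReal.ofReal c) (opMap φ) where
  isProj hP := by
    obtain ⟨P, rfl⟩ := hP.exists_eq
    rw [opMap_op]
    exact (φ P).1.isProj
  orth hP hQ h := by
    obtain ⟨P, rfl⟩ := hP.exists_eq
    obtain ⟨Q, rfl⟩ := hQ.exists_eq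
    have hP' := hasProjTrace_op (φ P)
    have hQ' := hasProjTrace_op (φ Q)
    have htop : ENNReal.ofReal c ≠ ∞ := ENNReal.ofReal_ne_top
    rw [opMap_op, opMap_op, mul_eq_zero_iff_opTrace hτ hP'.1 hQ'.1 (hP'.2 ▸ htop) (hQ'.2 ▸ htop),
      hφ.opTrace_add_mul_self, hP'.2, hQ'.2, ← hP.2]
    nth_rewrite 2 [hP.2]
    rw [← hQ.2]
    exact (mul_eq_zero_iff_opTrace hτ hP.1 hQ.1 (hP.2 ▸ htop) (hQ.2 ▸ htop)).1 h
  add hP hQ hR hS h := by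
    obtain ⟨P, rfl⟩ := hP.exists_eq
    obtain ⟨Q, rfl⟩ := hQ.exists_eq
    obtain ⟨R, rfl⟩ := hR.exists_eq
    obtain ⟨S, rfl⟩ := hS.exists_eq
    have hP' := hasProjTrace_op (φ P)
    have hQ' := hasProjTrace_op (φ Q)
    have hR' := hasProjTrace_op (φ R)
    have hS' := hasProjTrace_op (φ S)
    have htop : ENNReal.ofReal c ≠ ∞ := ENNReal.ofReal_ne_top
    rw [opMap_op, opMap_op, opMap_op, opMap_op]
    have h1 := opTrace_sub_mul_self (τ := τ) hP.1 hQ.1 hR.1 hS.1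
    have h2 := opTrace_sub_mul_self (τ := τ) hP'.1 hQ'.1 hR'.1 hS'.1
    simp only [hφ.opTrace_add_mul_self, hP'.2, hQ'.2, hR'.2, hS'.2] at h2
    simp only [hP.2, hQ.2, hR.2, hS.2] at h1
    rw [← h1, h, sub_self, mul_zero, opTrace_zero] at h2
    have hfin : ∀ {A B : H →L[ℂ] H}, HasProjTrace τ (ENNReal.ofReal c) A →
        HasProjTrace τ (ENNReal.ofReal c) B → opTrace τ ((A + B) * (A + B)) ≠ ∞ :=
      fun hA hB => opTrace_add_mul_self_ne_top hA.1 hB.1 (hA.2 ▸ htop) (hB.2 ▸ htop)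
    have h3 := (ENNReal.add_left_inj (ENNReal.add_ne_top.2
      ⟨ENNReal.add_ne_top.2 ⟨hfin hP hR, hfin hP hS⟩,
        ENNReal.add_ne_top.2 ⟨hfin hQ hR, hfin hQ hS⟩⟩)).1 h2
    have h4 := opTrace_eq_zero hτ (star_mul_self_mem_posCone
      (sub_mem (add_mem hP'.1.1 hQ'.1.1) (add_mem hR'.1.1 hS'.1.1))) h3
    exact sub_eq_zero.1 ((CStarRing.star_mul_self_eq_zero_iff _).1 h4)

end
end SemifiniteFactor

open SemifiniteFactor in
theorem mainTheorem4 {H : Type*} [NormedAddCommGroup H] [InnerProductSpace ℂ H] [CompleteSpace H]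
    (M : VonNeumannAlgebra H) (hM : IsFactor M) (hI₂ : ¬ IsTypeI₂ M)
    (τ : posCone M →ₗ[ℝ≥0] ℝ≥0∞) (hτ : IsTrace τ)
    (c : ℝ) (hc0 : 0 < c) (hc : ENNReal.ofReal c < τ (Proj.top M).toPos / 2)
    (φ : Grassmann τ c → Grassmann τ c) (hφ : PreservesTransitionProbability τ φ)
    (P₁ P₂ Q : Grassmann τ c) (hcomm : P₁.1.op * P₂.1.op = P₂.1.op * P₁.1.op)
    (hQ : (Q : Proj M) ≤ (P₁ : Proj M) ⊔ (P₂ : Proj M)) :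
    (φ Q : Proj M) ≤ (φ P₁ : Proj M) ⊔ (φ P₂ : Proj M) := by
  have hC1 : ENNReal.ofReal c + ENNReal.ofReal c < opTrace τ (1 : H →L[ℂ] H) := by
    have h1 := (ENNReal.lt_div_iff_mul_lt (by simp) (by simp)).1 hc
    rw [mul_two, ← opTrace_toPos] at h1
    exact h1
  -- for commuting projections the join is `P₁ + P₂ - P₁ P₂`
  have hN : IsProj M (P₁.1.op + P₂.1.op - P₁.1.op * P₂.1.op) :=
    ⟨sub_mem (add_mem P₁.1.isProj.1 P₂.1.isProj.1) (mul_mem P₁.1.isProj.1 P₂.1.isProj.1),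
      P₁.1.isProj.2.add_sub_mul_of_commute hcomm P₂.1.isProj.2⟩
  have hle : (Q : Proj M) ≤ ⟨_, hN⟩ := by
    refine hQ.trans (sup_le (Proj.le_iff_mul_eq.2 ?_) (Proj.le_iff_mul_eq.2 ?_))
    · change (P₁.1.op + P₂.1.op - P₁.1.op * P₂.1.op) * P₁.1.op = P₁.1.op
      rw [hcomm, sub_mul, add_mul, mul_assoc, P₁.1.isProj.mul_self, add_sub_cancel_right]
    · change (P₁.1.op + P₂.1.op - P₁.1.op * P₂.1.op) * P₂.1.op = P₂.1.op
      rw [sub_mul, add_mul, mul_assoc, P₂.1.isProj.mul_self, add_sub_cancel_left]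
  have h := (hφ.isOrthoAdditive hτ).mul_eq_of_le hM hτ ENNReal.ofReal_ne_top hC1
    (J := ((φ P₁ : Proj M) ⊔ (φ P₂ : Proj M)).op) (hasProjTrace_op P₁) (hasProjTrace_op P₂)
    (hasProjTrace_op Q) hcomm (Proj.le_iff_mul_eq.1 hle)
    (by rw [opMap_op]; exact Proj.le_iff_mul_eq.1 le_sup_left)
    (by rw [opMap_op]; exact Proj.le_iff_mul_eq.1 le_sup_right)
  rw [opMap_op] at h
  exact Proj.le_iff_mul_eq.2 h
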